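/- Let $L,\rho_1,\rho_2,\rho_3,k,b,\gamma,\kappa,\delta,\mu,\tau_0>0$ and consider on $(0,\infty)\times(0,L)$ the linear system $$\rho_1\varphi_{tt}-k(\varphi_x+\psi)_x+\mu\varphi_t=0,\qquad \rho_2\psi_{tt}-b\psi_{xx}+k(\varphi_x+\psi)+\gamma\theta_x=0,$$ $$\rho_3\theta_t+\kappa q_x+\gamma\psi_{tx}=0,\qquad \tau_0q_t+\delta q+\kappa\theta_x=0$$ with boundary conditions $\varphi=\psi=q=0$ at $x=0$ and $x=L$. Let $$\mathcal H=H^1_0(0,L)\times L^2(0,L)\times H^1_0(0,L)\times L^2(0,L)\times L^2(0,L)\times L^2(0,L)$$ (real-valued functions) with the inner product $$\langle V,W\rangle_{\mathcal H}=\rho_1\langle V^2,W^2\rangle+\rho_2\langle V^4,W^4\rangle+b\langle V^3_x,W^3_x\rangle+k\langle V^1_x+V^3,W^1_x+W^3\rangle+\rho_3\langle V^5,W^5\rangle+\tau_0\langle V^6,W^6\rangle,$$ where $\langle\cdot,\cdot\rangle$ on the right is the inner product of $L^2(0,L)$. Let $A$ be the operator on $\mathcal H$ with domain $$D(A)=\{V\in\mathcal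 H: V^1,V^3\in H^2(0,L)\cap H^1_0(0,L),\ V^2,V^4,V^6\in H^1_0(0,L),\ V^5\in H^1(0,L)\}$$ and $$AV=\Big(V^2,\ \tfrac{k}{\rho_1}(V^1_x+V^3)_x-\tfrac{\mu}{\rho_1}V^2,\ V^4,\ \tfrac b{\rho_2}V^3_{xx}-\tfrac k{\rho_2}(V^1_x+V^3)-\tfrac\gamma{\rho_2}V^5_x,\ -\tfrac\gamma{\rho_3}V^4_x-\tfrac\kappa{\rho_3}V^6_x,\ -\tfrac\kappa{\tau_0}V^5_x-\tfrac\delta{\tau_0}V^6\Big),$$ so that the system reads $V_t=AV$ for $V=(\varphi,\varphi_t,\psi,\psi_t,\theta,q)$. The powers $A^n$ have their natural domains, $D(A^0)=\mathcal H$, $D(A^{n+1})=\{V\in D(A^n):A^nV\in D(A)\}$, and $D(A^n)$ carries the graph norm $\sum_{j\le n}\|A^jV\|_{\mathcal H}$. Then $\mathcal H$ is a Hilbert space, and $A$ is the infinitesimal generator of a $C_0$-semigroup of contractions $\{e^{At}\}_{t\ge0}$ on $\mathcal H$. For every $V_0\in D(A)$ the problem $V_t=AV$ on $[0,\infty)$,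 $V(0)=V_0$, has a unique solution $V\in C^1([0,\infty),\mathcal H)\cap C^0([0,\infty),D(A))$, and it is given by $V(t)=e^{At}V_0$. If $n\in\mathbb N$ and $V_0\in D(A^n)$, then $t\mapsto e^{At}V_0$ belongs to $C^0([0,\infty),D(A^n))$. -/

import Mathlib

open Set Filter Topology MeasureTheory
open scoped NNReal ContDiff

noncomputable section

/-! ### Unbounded operators, `C₀`-semigroups and classical solutions -/

section Semigroups

variable {X : Type*} [AddCommGroup X] [Module ℝ X]

/-- The composition `g ∘ f` of unbounded operators, with its natural domain
`{x ∈ D(f) | f x ∈ D(g)}`. -/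
def opComp (g f : X →ₗ.[ℝ] X) : X →ₗ.[ℝ] X where
  domain := (g.domain.comap f.toFun).map f.domain.subtype
  toFun :=
    { toFun := fun x => g ⟨f ⟨x.1, by
          obtain ⟨y, _, hy⟩ := x.2
          exact hy ▸ y.2⟩, by
          obtain ⟨x, y, hy, rfl⟩ := x
          exact hy⟩
      map_add' := by
        rintro ⟨_, x, hx, rfl⟩ ⟨_, y, hy, rfl⟩
        rw [← LinearPMap.map_add]
        congr 1
        apply Subtype.ext
        exact f.map_add x y
      map_smul' := by
        rintro c ⟨_, x, hx, rfl⟩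
        rw [RingHom.id_apply, ← LinearPMap.map_smul]
        congr 1
        apply Subtype.ext
        exact f.map_smul c x }

/-- The powers `Aⁿ` of an unbounded operator, with `D(A⁰) = X` and
`D(Aⁿ⁺¹) = {x ∈ D(Aⁿ) | Aⁿ x ∈ D(A)}`. -/
def opPow (A : X →ₗ.[ℝ] X) : ℕ → (X →ₗ.[ℝ] X)
  | 0 => (LinearMap.id : X →ₗ[ℝ] X).toPMap ⊤
  | n + 1 => opComp A (opPow A n)

end Semigroups

section Semigroups

variable {X : Type*} [NormedAddCommGroup X] [NormedSpace ℝ X]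

variable (X) in
/-- A `C₀`-semigroup of bounded linear operators on `X`. -/
structure C0Semigroup where
  toFun : ℝ≥0 → X →L[ℝ] X
  map_zero' : toFun 0 = ContinuousLinearMap.id ℝ X
  map_add' : ∀ s t, toFun (s + t) = (toFun s).comp (toFun t)
  tendsto_zero' : ∀ x, Tendsto (fun t => toFun t x) (𝓝 0) (𝓝 x)

/-- All operators of the semigroup have operator norm at most one. -/
def C0Semigroup.IsContraction (S : C0Semigroup X) : Prop :=
  ∀ t, ‖S.toFun t‖ ≤ 1

/-- `A` is the infinitesimal generator of `S`: `x ∈ D(A)` and `A x = y` if and only if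
`(S(h) x - x) / h → y` as `h → 0+`. -/
def C0Semigroup.IsGeneratedBy (S : C0Semigroup X) (A : X →ₗ.[ℝ] X) : Prop :=
  ∀ x y, (x, y) ∈ A.graph ↔
    Tendsto (fun h : ℝ≥0 => (h : ℝ)⁻¹ • (S.toFun h x - x)) (𝓝[>] 0) (𝓝 y)

/-- The orbit `t ↦ S(t) x`, as a function of a real variable (only `t ≥ 0` matters). -/
def C0Semigroup.orbit (S : C0Semigroup X) (x : X) : ℝ → X :=
  fun t => S.toFun t.toNNReal x

/-- `V ∈ C⁰([0, ∞), D(Aⁿ))`, where `D(Aⁿ)` carries its graph norm `∑_{j ≤ n} ‖Aʲ x‖`: for every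
`j ≤ n` and `t ≥ 0` one has `V t ∈ D(Aʲ)`, and `t ↦ Aʲ (V t)` is continuous on `[0, ∞)`. -/
def ContinuousIntoDomPow (A : X →ₗ.[ℝ] X) (n : ℕ) (V : ℝ → X) : Prop :=
  ∀ j ≤ n, ∃ W : ℝ → X, ContinuousOn W (Ici 0) ∧ ∀ t ∈ Ici (0 : ℝ), (V t, W t) ∈ (opPow A j).graph

/-- `V ∈ C¹([0, ∞), X) ∩ C⁰([0, ∞), D(A))` solves `V_t = A V`, `V(0) = V₀`. -/
structure IsClassicalSolution (A : X →ₗ.[ℝ] X) (V₀ : X) (V : ℝ → X) : Prop where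
  contDiffOn : ContDiffOn ℝ 1 V (Ici 0)
  continuousIntoDom : ContinuousIntoDomPow A 1 V
  equation : ∀ t ∈ Ici (0 : ℝ), (V t, derivWithin V (Ici 0) t) ∈ A.graph
  initial : V 0 = V₀

end Semigroups

/-! ### Sobolev spaces on the interval `(0, L)` -/

/-- Lebesgue measure on `(0, L)`. -/
abbrev μI (L : ℝ) : Measure ℝ := volume.restrict (Ioo 0 L)

/-- The space `L²((0, L))`. -/
abbrev L2 (L : ℝ) : Type := Lp ℝ 2 (μI L)

/-- `φ ∈ C_c^∞((0, L))`, extended by zero to `ℝ`. -/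
structure IsTest (L : ℝ) (φ : ℝ → ℝ) : Prop where
  contDiff : ContDiff ℝ ∞ φ
  hasCompactSupport : HasCompactSupport φ
  tsupport_subset : tsupport φ ⊆ Ioo 0 L

theorem IsTest.continuous_deriv {L : ℝ} {φ : ℝ → ℝ} (h : IsTest L φ) : Continuous (deriv φ) :=
  h.contDiff.continuous_deriv (by simp)

theorem IsTest.memLp {L : ℝ} {φ : ℝ → ℝ} (h : IsTest L φ) : MemLp φ 2 (μI L) :=
  h.contDiff.continuous.memLp_of_hasCompactSupport h.hasCompactSupport

theorem IsTest.memLp_deriv {L : ℝ} {φ : ℝ → ℝ} (h : IsTest L φ) : MemLp (deriv φ) 2 (μI L) :=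
  h.continuous_deriv.memLp_of_hasCompactSupport h.hasCompactSupport.deriv

theorem integrable_L2_mul {L : ℝ} (u : L2 L) {f : ℝ → ℝ} (hf : MemLp f 2 (μI L)) :
    Integrable (fun x => u x * f x) (μI L) :=
  (Lp.memLp u).integrable_mul hf

/-- `v` is the weak derivative of `u` on `(0, L)`. -/
def HasWeakDeriv (L : ℝ) (u v : L2 L) : Prop :=
  ∀ φ, IsTest L φ → ∫ x in Ioo 0 L, u x * deriv φ x = -∫ x in Ioo 0 L, v x * φ x

theorem integral_L2_add_mul {L : ℝ} (u v : L2 L) {f : ℝ → ℝ} (hf : MemLp f 2 (μI L)) :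
    ∫ x in Ioo 0 L, (u + v : L2 L) x * f x
      = (∫ x in Ioo 0 L, u x * f x) + ∫ x in Ioo 0 L, v x * f x := by
  rw [← integral_add (integrable_L2_mul u hf) (integrable_L2_mul v hf)]
  apply integral_congr_ae
  filter_upwards [Lp.coeFn_add u v] with x hx
  rw [hx, Pi.add_apply, add_mul]

theorem integral_L2_smul_mul {L : ℝ} (c : ℝ) (u : L2 L) (f : ℝ → ℝ) :
    ∫ x in Ioo 0 L, (c • u : L2 L) x * f x = c * ∫ x in Ioo 0 L, u x * f x := by
  rw [← integral_const_mul]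
  apply integral_congr_ae
  filter_upwards [Lp.coeFn_smul c u] with x hx
  rw [hx, Pi.smul_apply, smul_eq_mul, mul_assoc]

theorem integral_L2_zero_mul {L : ℝ} (f : ℝ → ℝ) :
    ∫ x in Ioo 0 L, (0 : L2 L) x * f x = 0 := by
  simpa using integral_L2_smul_mul 0 (0 : L2 L) f

/-- The graph of the weak derivative in `L²((0, L)) × L²((0, L))`. -/
def weakDerivGraph (L : ℝ) : Submodule ℝ (L2 L × L2 L) where
  carrier := {p | HasWeakDeriv L p.1 p.2}
  add_mem' := by
    intro p q hp hq φ hφ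
    simp only [Prod.fst_add, Prod.snd_add]
    rw [integral_L2_add_mul _ _ hφ.memLp_deriv, integral_L2_add_mul _ _ hφ.memLp, hp φ hφ, hq φ hφ]
    ring
  zero_mem' := by
    intro φ _
    simp only [Prod.fst_zero, Prod.snd_zero]
    rw [integral_L2_zero_mul, integral_L2_zero_mul, neg_zero]
  smul_mem' := by
    intro c p hp φ hφ
    simp only [Prod.smul_fst, Prod.smul_snd]
    rw [integral_L2_smul_mul, integral_L2_smul_mul, hp φ hφ]
    ring

/-- An element of `L²((0, L))` that is orthogonal to all test functions vanishes. -/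
theorem L2_eq_zero_of_test {L : ℝ} (u : L2 L)
    (h : ∀ φ, IsTest L φ → ∫ x in Ioo 0 L, u x * φ x = 0) : u = 0 := by
  have hint : IntegrableOn u (Ioo 0 L) volume := (Lp.memLp u).integrable (by norm_num)
  have key := isOpen_Ioo.ae_eq_zero_of_integral_contDiff_smul_eq_zero
    hint.locallyIntegrableOn (by
      intro g hg hgc hgs
      have h1 := h g ⟨hg, hgc, hgs⟩
      have h2 : ∫ x, g x • u x = ∫ x in Ioo 0 L, g x • u x := by
        symm
        apply setIntegral_eq_integral_of_forall_compl_eq_zero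
        intro x hx
        have : g x = 0 := image_eq_zero_of_notMem_tsupport fun hx' => hx (hgs hx')
        simp [this]
      rw [h2]
      refine Eq.trans ?_ h1
      exact integral_congr_ae (Eventually.of_forall fun x => mul_comm _ _))
  apply (Lp.eq_zero_iff_ae_eq_zero).2
  rw [← ae_restrict_iff' measurableSet_Ioo] at key
  exact key

/-- The weak derivative `∂ₓ` as an unbounded operator on `L²((0, L))`; its domain is
`H¹((0, L))`. The graph is functional by `weakDeriv_unique` below. -/
def weakD (L : ℝ) : L2 L →ₗ.[ℝ] L2 L := (weakDerivGraph L).toLinearPMap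

theorem weakDeriv_unique {L : ℝ} (p : L2 L × L2 L) (hp : p ∈ weakDerivGraph L) (h : p.1 = 0) :
    p.2 = 0 := by
  apply L2_eq_zero_of_test
  intro φ hφ
  have := hp φ hφ
  rw [h, integral_L2_zero_mul] at this
  linarith

/-- The Sobolev space `H¹((0, L))`. -/
abbrev H1 (L : ℝ) : Submodule ℝ (L2 L) := (weakD L).domain

theorem mem_H1_iff {L : ℝ} (u : L2 L) : u ∈ H1 L ↔ ∃ v, HasWeakDeriv L u v := by
  constructor
  · rintro ⟨⟨_, v⟩, h, rfl⟩
    exact ⟨v, h⟩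
  · rintro ⟨v, h⟩
    exact ⟨(u, v), h, rfl⟩

theorem hasWeakDeriv_weakD {L : ℝ} (u : H1 L) : HasWeakDeriv L u (weakD L u) :=
  Submodule.mem_graph_toLinearPMap (fun p hp h => weakDeriv_unique p hp h) u

theorem weakD_eq {L : ℝ} (u : H1 L) {v : L2 L} (h : HasWeakDeriv L u v) : weakD L u = v := by
  have := weakDeriv_unique (((u : L2 L), weakD L u) - ((u : L2 L), v))
    ((weakDerivGraph L).sub_mem (hasWeakDeriv_weakD u) h) (by simp)
  exact sub_eq_zero.1 this

/-- The second weak derivative `∂ₓ²` as an unbounded operator on `L²((0, L))`. -/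
def weakD2 (L : ℝ) : L2 L →ₗ.[ℝ] L2 L := opComp (weakD L) (weakD L)

/-- The Sobolev space `H²((0, L))`. -/
abbrev H2 (L : ℝ) : Submodule ℝ (L2 L) := (weakD2 L).domain

/-- The pairs `(φ, φ')` in `L²((0, L)) × L²((0, L))` with `φ ∈ C_c^∞((0, L))`. -/
def testGraph (L : ℝ) : Submodule ℝ (L2 L × L2 L) where
  carrier := {p | ∃ φ, IsTest L φ ∧ p.1 =ᵐ[μI L] φ ∧ p.2 =ᵐ[μI L] deriv φ}
  add_mem' := by
    rintro p q ⟨φ, hφ, hp1, hp2⟩ ⟨ψ, hψ, hq1, hq2⟩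
    refine ⟨φ + ψ, ⟨hφ.contDiff.add hψ.contDiff, hφ.hasCompactSupport.add hψ.hasCompactSupport,
      (tsupport_add φ ψ).trans (union_subset hφ.tsupport_subset hψ.tsupport_subset)⟩, ?_, ?_⟩
    · exact (Lp.coeFn_add p.1 q.1).trans (hp1.add hq1)
    · have : deriv (φ + ψ) = deriv φ + deriv ψ := by
        ext x
        exact deriv_add (hφ.contDiff.differentiable (by simp) x)
          (hψ.contDiff.differentiable (by simp) x)
      rw [this]
      exact (Lp.coeFn_add p.2 q.2).trans (hp2.add hq2)
  zero_mem' := by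
    refine ⟨0, ⟨contDiff_const, HasCompactSupport.zero, by simp⟩, Lp.coeFn_zero _ _ _, ?_⟩
    have : deriv (0 : ℝ → ℝ) = 0 := by ext x; simp
    rw [this]
    exact Lp.coeFn_zero _ _ _
  smul_mem' := by
    rintro c p ⟨φ, hφ, hp1, hp2⟩
    refine ⟨c • φ, ⟨hφ.contDiff.const_smul c, hφ.hasCompactSupport.smul_left,
      (closure_mono (Function.support_const_smul_subset c φ)).trans hφ.tsupport_subset⟩, ?_, ?_⟩
    · exact (Lp.coeFn_smul c p.1).trans (hp1.const_smul c)
    · have : deriv (c • φ) = c • deriv φ := by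
        ext x
        exact deriv_const_smul c (hφ.contDiff.differentiable (by simp) x)
      rw [this]
      exact (Lp.coeFn_smul c p.2).trans (hp2.const_smul c)

/-- The Sobolev space `H¹₀((0, L))`: the closure of `C_c^∞((0, L))` in `H¹((0, L))`, that is, all
`u ∈ H¹((0, L))` such that `(u, u')` is a limit in `L² × L²` of pairs `(φ, φ')` with
`φ ∈ C_c^∞((0, L))`. -/
def H10 (L : ℝ) : Submodule ℝ (L2 L) :=
  ((testGraph L).topologicalClosure.comap
    ((H1 L).subtype.prod (weakD L).toFun)).map (H1 L).subtype

theorem H10_le_H1 (L : ℝ) : H10 L ≤ H1 L := by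
  rintro _ ⟨u, _, rfl⟩
  exact u.2

theorem mem_H10_iff {L : ℝ} (u : H1 L) :
    (u : L2 L) ∈ H10 L ↔ ((u : L2 L), weakD L u) ∈ closure (testGraph L : Set (L2 L × L2 L)) := by
  constructor
  · rintro ⟨w, hw, hwu⟩
    obtain rfl : w = u := Subtype.ext hwu
    exact hw
  · intro h
    exact ⟨u, h, rfl⟩

/-- The weak derivative on `H¹₀((0, L))`. -/
def D0 (L : ℝ) : H10 L →ₗ[ℝ] L2 L := (weakD L).toFun ∘ₗ Submodule.inclusion (H10_le_H1 L)

theorem D0_mem_closure {L : ℝ} (u : H10 L) :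
    ((u : L2 L), D0 L u) ∈ closure (testGraph L : Set (L2 L × L2 L)) :=
  (mem_H10_iff ⟨u, H10_le_H1 L u.2⟩).1 u.2

/-- A function in `H¹₀((0, L))` with vanishing weak derivative is zero. -/
theorem H10_eq_zero_of_D0_eq_zero {L : ℝ} (hL : 0 ≤ L) (u : H10 L) (hu : D0 L u = 0) : u = 0 := by
  apply Subtype.ext
  apply L2_eq_zero_of_test
  intro φ hφ
  set Φ : ℝ → ℝ := fun x => ∫ y in (0 : ℝ)..x, φ y with hΦ
  have hΦd : ∀ x, HasDerivAt Φ (φ x) x := fun x =>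
    hφ.contDiff.continuous.integral_hasStrictDerivAt 0 x |>.hasDerivAt
  have hΦc : Continuous Φ := continuous_iff_continuousAt.2 fun x => (hΦd x).continuousAt
  have hΦm : MemLp Φ 2 (μI L) := by
    obtain ⟨C, hC⟩ := isCompact_Icc.exists_bound_of_continuousOn (hΦc.continuousOn (s := Icc 0 L))
    refine MemLp.of_bound hΦc.aestronglyMeasurable C ?_
    filter_upwards [ae_restrict_mem measurableSet_Ioo] with x hx
    exact hC x (Ioo_subset_Icc_self hx)
  have hφm := hφ.memLp
  have hcl : closure (testGraph L : Set (L2 L × L2 L)) ⊆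
      {p | inner ℝ (hφm.toLp φ) p.1 + inner ℝ (hΦm.toLp Φ) p.2 = 0} := by
    apply closure_minimal
    · rintro p ⟨η, hη, hp1, hp2⟩
      simp only [mem_ofPred_eq, L2.inner_def]
      have e1 : ∫ x in Ioo 0 L, inner ℝ (hφm.toLp φ x) (p.1 x) = ∫ x in Ioo 0 L, η x * φ x := by
        apply integral_congr_ae
        filter_upwards [hφm.coeFn_toLp, hp1] with x h1 h2
        rw [h1, h2]; simp
      have e2 : ∫ x in Ioo 0 L, inner ℝ (hΦm.toLp Φ x) (p.2 x)
          = ∫ x in Ioo 0 L, deriv η x * Φ x := by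
        apply integral_congr_ae
        filter_upwards [hΦm.coeFn_toLp, hp2] with x h1 h2
        rw [h1, h2]; simp
      have i1 : Integrable (fun x => η x * φ x) (μI L) := hη.memLp.integrable_mul hφm
      have i2 : Integrable (fun x => deriv η x * Φ x) (μI L) := hη.memLp_deriv.integrable_mul hΦm
      rw [e1, e2, ← integral_add i1 i2, ← integral_Ioc_eq_integral_Ioo,
        ← intervalIntegral.integral_of_le hL]
      have hd : ∀ x ∈ uIcc 0 L, HasDerivAt (fun x => η x * Φ x) (η x * φ x + deriv η x * Φ x) x := by
        intro x _
        have := ((hη.contDiff.differentiable (by simp) x).hasDerivAt).mul (hΦd x)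
        rw [add_comm]
        exact this
      rw [intervalIntegral.integral_eq_sub_of_hasDerivAt hd
        (((hη.contDiff.continuous.mul hφ.contDiff.continuous).add
          (hη.continuous_deriv.mul hΦc)).intervalIntegrable _ _)]
      have h0 : η 0 = 0 := image_eq_zero_of_notMem_tsupport fun h => by
        simpa using hη.tsupport_subset h
      have h1 : η L = 0 := image_eq_zero_of_notMem_tsupport fun h => by
        simpa using hη.tsupport_subset h
      simp [h0, h1]
    · exact isClosed_eq (by fun_prop) continuous_const
  have := hcl (D0_mem_closure u)
  rw [mem_ofPred_eq, hu, inner_zero_right, add_zero, L2.inner_def] at this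
  refine Eq.trans ?_ this
  apply integral_congr_ae
  filter_upwards [hφm.coeFn_toLp] with x h1
  rw [h1]; simp

/-! ### The Timoshenko system with Cattaneo heat conduction -/

/-- The (positive) length of the beam and the (positive) coefficients of the system. -/
structure BeamCoeffs where
  L : ℝ
  ρ₁ : ℝ
  ρ₂ : ℝ
  ρ₃ : ℝ
  k : ℝ
  b : ℝ
  γ : ℝ
  κ : ℝ
  δ : ℝ
  μ : ℝ
  τ₀ : ℝ
  L_pos : 0 < L
  ρ₁_pos : 0 < ρ₁
  ρ₂_pos : 0 < ρ₂
  ρ₃_pos : 0 < ρ₃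
  k_pos : 0 < k
  b_pos : 0 < b
  γ_pos : 0 < γ
  κ_pos : 0 < κ
  δ_pos : 0 < δ
  μ_pos : 0 < μ
  τ₀_pos : 0 < τ₀

/-- The energy space `H¹₀ × L² × H¹₀ × L² × L² × L²` on `(0, L)`. -/
def EnergySpace (P : BeamCoeffs) : Type :=
  H10 P.L × L2 P.L × H10 P.L × L2 P.L × L2 P.L × L2 P.L

namespace EnergySpace

variable {P : BeamCoeffs}

instance : AddCommGroup (EnergySpace P) :=
  inferInstanceAs (AddCommGroup (H10 P.L × L2 P.L × H10 P.L × L2 P.L × L2 P.L × L2 P.L))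

instance : Module ℝ (EnergySpace P) :=
  inferInstanceAs (Module ℝ (H10 P.L × L2 P.L × H10 P.L × L2 P.L × L2 P.L × L2 P.L))

/-- The component `φ` of `V = (φ, φ_t, ψ, ψ_t, θ, q)`. -/
def V1 : EnergySpace P →ₗ[ℝ] H10 P.L where
  toFun V := V.1
  map_add' _ _ := rfl
  map_smul' _ _ := rfl

/-- The component `φ_t`. -/
def V2 : EnergySpace P →ₗ[ℝ] L2 P.L where
  toFun V := V.2.1
  map_add' _ _ := rfl
  map_smul' _ _ := rfl

/-- The component `ψ`. -/
def V3 : EnergySpace P →ₗ[ℝ] H10 P.L where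
  toFun V := V.2.2.1
  map_add' _ _ := rfl
  map_smul' _ _ := rfl

/-- The component `ψ_t`. -/
def V4 : EnergySpace P →ₗ[ℝ] L2 P.L where
  toFun V := V.2.2.2.1
  map_add' _ _ := rfl
  map_smul' _ _ := rfl

/-- The component `θ`. -/
def V5 : EnergySpace P →ₗ[ℝ] L2 P.L where
  toFun V := V.2.2.2.2.1
  map_add' _ _ := rfl
  map_smul' _ _ := rfl

/-- The component `q`. -/
def V6 : EnergySpace P →ₗ[ℝ] L2 P.L where
  toFun V := V.2.2.2.2.2
  map_add' _ _ := rfl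
  map_smul' _ _ := rfl

/-- Build an element of the energy space from its components. -/
def mk (v1 : H10 P.L) (v2 : L2 P.L) (v3 : H10 P.L) (v4 v5 v6 : L2 P.L) : EnergySpace P :=
  (v1, v2, v3, v4, v5, v6)

section

variable (v1 : H10 P.L) (v2 : L2 P.L) (v3 : H10 P.L) (v4 v5 v6 : L2 P.L)

theorem V1_mk : V1 (mk v1 v2 v3 v4 v5 v6) = v1 := rfl

theorem V2_mk : V2 (mk v1 v2 v3 v4 v5 v6) = v2 := rfl

theorem V3_mk : V3 (mk v1 v2 v3 v4 v5 v6) = v3 := rfl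

theorem V4_mk : V4 (mk v1 v2 v3 v4 v5 v6) = v4 := rfl

theorem V5_mk : V5 (mk v1 v2 v3 v4 v5 v6) = v5 := rfl

theorem V6_mk : V6 (mk v1 v2 v3 v4 v5 v6) = v6 := rfl

end

@[ext]
theorem ext {V W : EnergySpace P} (h1 : V1 V = V1 W) (h2 : V2 V = V2 W) (h3 : V3 V = V3 W)
    (h4 : V4 V = V4 W) (h5 : V5 V = V5 W) (h6 : V6 V = V6 W) : V = W :=
  Prod.ext h1 (Prod.ext h2 (Prod.ext h3 (Prod.ext h4 (Prod.ext h5 h6))))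

/-- The energy inner product. -/
def energyInner (V W : EnergySpace P) : ℝ :=
  P.ρ₁ * inner ℝ (V2 V) (V2 W) + P.ρ₂ * inner ℝ (V4 V) (V4 W)
    + P.b * inner ℝ (D0 P.L (V3 V)) (D0 P.L (V3 W))
    + P.k * inner ℝ (D0 P.L (V1 V) + (V3 V : L2 P.L)) (D0 P.L (V1 W) + (V3 W : L2 P.L))
    + P.ρ₃ * inner ℝ (V5 V) (V5 W) + P.τ₀ * inner ℝ (V6 V) (V6 W)

/-- The energy inner product is an inner product. -/
@[reducible]
def core : InnerProductSpace.Core ℝ (EnergySpace P) where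
  inner := energyInner
  conj_inner_symm V W := by
    simp only [energyInner, conj_trivial]
    rw [real_inner_comm (V2 V), real_inner_comm (V4 V), real_inner_comm (V5 V),
      real_inner_comm (V6 V), real_inner_comm (D0 P.L (V3 V)),
      real_inner_comm (D0 P.L (V1 V) + (V3 V : L2 P.L))]
  re_inner_nonneg V := by
    have := P.ρ₁_pos; have := P.ρ₂_pos; have := P.ρ₃_pos; have := P.k_pos; have := P.b_pos
    have := P.τ₀_pos
    simp only [energyInner, RCLike.re_to_real, real_inner_self_eq_norm_sq]
    positivity
  add_left U V W := by
    simp only [energyInner, map_add, Submodule.coe_add, inner_add_left]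
    ring
  smul_left V W c := by
    simp only [energyInner, map_smul, Submodule.coe_smul, ← smul_add, real_inner_smul_left,
      conj_trivial]
    ring
  definite V h := by
    have h1 := P.ρ₁_pos; have h2 := P.ρ₂_pos; have h3 := P.ρ₃_pos; have h4 := P.k_pos
    have h5 := P.b_pos; have h6 := P.τ₀_pos
    change energyInner V V = 0 at h
    simp only [energyInner, real_inner_self_eq_norm_sq] at h
    have key : ∀ c x : ℝ, 0 < c → c * x ^ 2 ≤ 0 → x = 0 := by
      intro c x hc hx
      have : x ^ 2 ≤ 0 := by
        by_contra! hlt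
        have := mul_pos hc hlt
        linarith
      exact pow_eq_zero_iff (two_ne_zero) |>.1 (le_antisymm this (sq_nonneg x))
    have p1 : 0 ≤ P.ρ₁ * ‖V2 V‖ ^ 2 := by positivity
    have p2 : 0 ≤ P.ρ₂ * ‖V4 V‖ ^ 2 := by positivity
    have p3 : 0 ≤ P.b * ‖D0 P.L (V3 V)‖ ^ 2 := by positivity
    have p4 : 0 ≤ P.k * ‖D0 P.L (V1 V) + (V3 V : L2 P.L)‖ ^ 2 := by positivity
    have p5 : 0 ≤ P.ρ₃ * ‖V5 V‖ ^ 2 := by positivity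
    have p6 : 0 ≤ P.τ₀ * ‖V6 V‖ ^ 2 := by positivity
    have e3 : V3 V = 0 := H10_eq_zero_of_D0_eq_zero P.L_pos.le _
      (norm_eq_zero.1 (key _ _ h5 (by linarith)))
    have e1 : V1 V = 0 := by
      apply H10_eq_zero_of_D0_eq_zero P.L_pos.le
      have : D0 P.L (V1 V) + (V3 V : L2 P.L) = 0 := norm_eq_zero.1 (key _ _ h4 (by linarith))
      simpa [e3] using this
    ext1
    · exact e1
    · exact norm_eq_zero.1 (key _ _ h1 (by linarith))
    · exact e3
    · exact norm_eq_zero.1 (key _ _ h2 (by linarith))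
    · exact norm_eq_zero.1 (key _ _ h3 (by linarith))
    · exact norm_eq_zero.1 (key _ _ h6 (by linarith))

instance : NormedAddCommGroup (EnergySpace P) := core.toNormedAddCommGroup

instance : InnerProductSpace ℝ (EnergySpace P) := InnerProductSpace.ofCore core.toCore

theorem inner_eq (V W : EnergySpace P) : inner ℝ V W = energyInner V W := rfl

end EnergySpace

open EnergySpace in
/-- The domain of the operator: `V¹, V³ ∈ H² ∩ H¹₀`, `V², V⁴ ∈ H¹₀`, `V⁵ ∈ H¹`, `V⁶ ∈ H¹₀`. -/
def beamDomain (P : BeamCoeffs) : Submodule ℝ (EnergySpace P) where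
  carrier := {V | (V1 V : L2 P.L) ∈ H2 P.L ∧ V2 V ∈ H10 P.L ∧ (V3 V : L2 P.L) ∈ H2 P.L ∧
    V4 V ∈ H10 P.L ∧ V5 V ∈ H1 P.L ∧ V6 V ∈ H10 P.L}
  add_mem' := by
    rintro V W ⟨a1, a2, a3, a4, a5, a6⟩ ⟨b1, b2, b3, b4, b5, b6⟩
    simp only [mem_ofPred_eq, map_add, Submodule.coe_add]
    exact ⟨add_mem a1 b1, add_mem a2 b2, add_mem a3 b3, add_mem a4 b4, add_mem a5 b5,
      add_mem a6 b6⟩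
  zero_mem' := by
    simp only [mem_ofPred_eq, map_zero, Submodule.coe_zero]
    exact ⟨zero_mem _, zero_mem _, zero_mem _, zero_mem _, zero_mem _, zero_mem _⟩
  smul_mem' := by
    rintro c V ⟨a1, a2, a3, a4, a5, a6⟩
    simp only [mem_ofPred_eq, map_smul, Submodule.coe_smul]
    exact ⟨Submodule.smul_mem _ c a1, Submodule.smul_mem _ c a2, Submodule.smul_mem _ c a3,
      Submodule.smul_mem _ c a4, Submodule.smul_mem _ c a5, Submodule.smul_mem _ c a6⟩

open EnergySpace in
/-- The operator `A` of the system
`ρ₁ φ_tt - k (φ_x + ψ)_x + μ φ_t = 0`, `ρ₂ ψ_tt - b ψ_xx + k (φ_x + ψ) + γ θ_x = 0`,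
`ρ₃ θ_t + κ q_x + γ ψ_tx = 0`, `τ₀ q_t + δ q + κ θ_x = 0`,
written as `V_t = A V` for `V = (φ, φ_t, ψ, ψ_t, θ, q)`. -/
def beamOp (P : BeamCoeffs) : EnergySpace P →ₗ.[ℝ] EnergySpace P where
  domain := beamDomain P
  toFun :=
    { toFun := fun V => EnergySpace.mk
        ⟨V2 V.1, V.2.2.1⟩
        ((P.k / P.ρ₁) • weakD2 P.L ⟨V1 V.1, V.2.1⟩ - (P.μ / P.ρ₁) • V2 V.1
          + (P.k / P.ρ₁) • D0 P.L (V3 V.1))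
        ⟨V4 V.1, V.2.2.2.2.1⟩
        (-((P.k / P.ρ₂) • D0 P.L (V1 V.1)) + (P.b / P.ρ₂) • weakD2 P.L ⟨V3 V.1, V.2.2.2.1⟩
          - (P.k / P.ρ₂) • (V3 V.1 : L2 P.L) - (P.γ / P.ρ₂) • weakD P.L ⟨V5 V.1, V.2.2.2.2.2.1⟩)
        (-((P.γ / P.ρ₃) • D0 P.L ⟨V4 V.1, V.2.2.2.2.1⟩)
          - (P.κ / P.ρ₃) • D0 P.L ⟨V6 V.1, V.2.2.2.2.2.2⟩)
        (-((P.κ / P.τ₀) • weakD P.L ⟨V5 V.1, V.2.2.2.2.2.1⟩) - (P.δ / P.τ₀) • V6 V.1)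
      map_add' := by
        intro V W
        have e1 : weakD2 P.L ⟨V1 (V + W).1, (V + W).2.1⟩ = _ :=
          (weakD2 P.L).map_add ⟨V1 V.1, V.2.1⟩ ⟨V1 W.1, W.2.1⟩
        have e3 : weakD2 P.L ⟨V3 (V + W).1, (V + W).2.2.2.1⟩ = _ :=
          (weakD2 P.L).map_add ⟨V3 V.1, V.2.2.2.1⟩ ⟨V3 W.1, W.2.2.2.1⟩
        have e4 : D0 P.L ⟨V4 (V + W).1, (V + W).2.2.2.2.1⟩ = _ :=
          (D0 P.L).map_add ⟨V4 V.1, V.2.2.2.2.1⟩ ⟨V4 W.1, W.2.2.2.2.1⟩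
        have e5 : weakD P.L ⟨V5 (V + W).1, (V + W).2.2.2.2.2.1⟩ = _ :=
          (weakD P.L).map_add ⟨V5 V.1, V.2.2.2.2.2.1⟩ ⟨V5 W.1, W.2.2.2.2.2.1⟩
        have e6 : D0 P.L ⟨V6 (V + W).1, (V + W).2.2.2.2.2.2⟩ = _ :=
          (D0 P.L).map_add ⟨V6 V.1, V.2.2.2.2.2.2⟩ ⟨V6 W.1, W.2.2.2.2.2.2⟩
        apply EnergySpace.ext <;>
          simp only [map_add V1, map_add V2, map_add V3, map_add V4, map_add V5, map_add V6, V1_mk, V2_mk,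
            V3_mk, V4_mk, V5_mk, V6_mk]
        · exact Subtype.ext (map_add V2 V.1 W.1)
        · rw [e1]; simp only [Submodule.coe_add, map_add]; module
        · exact Subtype.ext (map_add V4 V.1 W.1)
        · rw [e3, e5]; simp only [Submodule.coe_add, map_add]; module
        · rw [e4, e6]; module
        · rw [e5]; simp only [Submodule.coe_add, map_add]; module
      map_smul' := by
        intro c V
        have e1 : weakD2 P.L ⟨V1 (c • V).1, (c • V).2.1⟩ = _ :=
          (weakD2 P.L).map_smul c ⟨V1 V.1, V.2.1⟩
        have e3 : weakD2 P.L ⟨V3 (c • V).1, (c • V).2.2.2.1⟩ = _ :=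
          (weakD2 P.L).map_smul c ⟨V3 V.1, V.2.2.2.1⟩
        have e4 : D0 P.L ⟨V4 (c • V).1, (c • V).2.2.2.2.1⟩ = _ :=
          (D0 P.L).map_smul c ⟨V4 V.1, V.2.2.2.2.1⟩
        have e5 : weakD P.L ⟨V5 (c • V).1, (c • V).2.2.2.2.2.1⟩ = _ :=
          (weakD P.L).map_smul c ⟨V5 V.1, V.2.2.2.2.2.1⟩
        have e6 : D0 P.L ⟨V6 (c • V).1, (c • V).2.2.2.2.2.2⟩ = _ :=
          (D0 P.L).map_smul c ⟨V6 V.1, V.2.2.2.2.2.2⟩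
        apply EnergySpace.ext <;>
          simp only [map_smul V1, map_smul V2, map_smul V3, map_smul V4, map_smul V5, map_smul V6, V1_mk,
            V2_mk, V3_mk, V4_mk, V5_mk, V6_mk]
        · exact Subtype.ext (map_smul V2 c V.1)
        · rw [e1]; simp only [Submodule.coe_smul, map_smul, RingHom.id_apply]; module
        · exact Subtype.ext (map_smul V4 c V.1)
        · rw [e3, e5]; simp only [Submodule.coe_smul, map_smul, RingHom.id_apply]; module
        · rw [e4, e6]; simp only [RingHom.id_apply]; module
        · rw [e5]; simp only [Submodule.coe_smul, map_smul, RingHom.id_apply]; module }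

end

/-!
The operator `A` is maximal dissipative on the energy space, and a maximal dissipative operator on
a Hilbert space generates a `C₀`-semigroup of contractions (Lumer–Phillips), whose orbits are the
unique classical solutions.

The energy space is complete because the energy controls `V³ₓ` and `V¹ₓ + V³`, hence by the
Poincaré inequality (`norm_le_D0`) the `H¹`-norms of `V³` and `V¹`, and `H¹₀` is the projection of
a closed subspace of `L² × L²` (`EnergySpace.completeSpace`).

Dissipativity is the energy identity `⟪A V, V⟫ = -μ ‖V²‖² - δ ‖V⁶‖²` (`inner_beamOp_self`). For
`l > 0` the equation `l V - A V = F` is solved by an orthogonal projection in a weighted `(L²)⁶`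
(`beamOp_surjective`).

The semigroup is the pointwise limit of the exponentials of the Yosida approximations
`n A (n - A)⁻¹` (`IsMaximalDissipative.exists_yosida`). These are bounded, dissipative and commute,
so the exponentials are contractions and `‖exp (t C) x - exp (t B) x‖ ≤ t ‖C x - B x‖`, which gives
convergence on the dense domain, hence everywhere. The first-order expansion
`norm_exp_smul_apply_sub_sub_le` is uniform in the approximation, and passing to the limit in it
shows that the generator extends `A`. Since the generator is dissipative and `1 - A` is onto, it
equals `A` (`IsMaximalDissipative.exists_semigroup`).

Orbits starting in the domain have the continuous right derivative `S(t) A x`, so they are `C¹`;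
`S(t)` commutes with all powers of `A`, which gives the regularity in `D(Aⁿ)`. Uniqueness holds
because the norm of the difference of two solutions is nonincreasing.
-/

/-! ### Maximal dissipative operators and their Yosida approximations -/

section Dissipative

variable {H : Type*} [NormedAddCommGroup H] [InnerProductSpace ℝ H]

/-- A curve whose velocity never points outwards has nonincreasing norm. -/
theorem norm_le_of_inner_deriv_nonpos {u u' : ℝ → H}
    (hu : ∀ t ∈ Ici (0 : ℝ), HasDerivWithinAt u (u' t) (Ici 0) t)
    (h : ∀ t ∈ Ici (0 : ℝ), inner ℝ (u' t) (u t) ≤ 0) {t : ℝ} (ht : 0 ≤ t) : ‖u t‖ ≤ ‖u 0‖ := by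
  have hanti : AntitoneOn (fun t => ‖u t‖ ^ 2) (Ici 0) := by
    apply antitoneOn_of_hasDerivWithinAt_nonpos (convex_Ici 0)
      (f' := fun t => 2 * inner ℝ (u t) (u' t))
    · exact fun t ht => (hu t ht).continuousWithinAt.norm.pow 2
    · intro t ht
      exact ((hu t (interior_subset ht)).mono interior_subset).norm_sq
    · intro t ht
      rw [real_inner_comm]
      linarith [h t (interior_subset ht)]
  exact pow_le_pow_iff_left₀ (norm_nonneg _) (norm_nonneg _) two_ne_zero |>.1
    (hanti self_mem_Ici ht ht)

/-- A maximal dissipative operator: it is dissipative, and `lam - A` is onto for all `lam > 0`. -/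
structure IsMaximalDissipative (A : H →ₗ.[ℝ] H) : Prop where
  dissipative : ∀ x : A.domain, inner ℝ (A x) (x : H) ≤ 0
  surjective : ∀ lam : ℝ, 0 < lam → ∀ y, ∃ x : A.domain, lam • (x : H) - A x = y

theorem IsMaximalDissipative.inner_nonpos {A : H →ₗ.[ℝ] H} (hA : IsMaximalDissipative A) {x z : H}
    (h : (x, z) ∈ A.graph) : inner ℝ z x ≤ 0 := by
  obtain ⟨y, rfl, rfl⟩ := (A.mem_graph_iff).1 h
  exact hA.dissipative y

theorem IsMaximalDissipative.exists_graph {A : H →ₗ.[ℝ] H} (hA : IsMaximalDissipative A)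
    {lam : ℝ} (hl : 0 < lam) (y : H) : ∃ x, (x, lam • x - y) ∈ A.graph := by
  obtain ⟨x, hx⟩ := hA.surjective lam hl y
  refine ⟨x, ?_⟩
  rw [← hx, sub_sub_cancel]
  exact A.mem_graph x

theorem IsMaximalDissipative.norm_le {A : H →ₗ.[ℝ] H} (hA : IsMaximalDissipative A)
    (lam : ℝ) {x z : H} (h : (x, z) ∈ A.graph) :
    lam * ‖x‖ ≤ ‖lam • x - z‖ := by
  have h1 := hA.inner_nonpos h
  have h2 := real_inner_le_norm (lam • x - z) x
  rw [inner_sub_left, real_inner_smul_left, real_inner_self_eq_norm_sq] at h2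
  rcases (norm_nonneg x).eq_or_lt with h0 | h0
  · rw [← h0]; simp
  · exact le_of_mul_le_mul_right (by linarith) h0

/-- The resolvent `(lam - A)⁻¹` as a bounded operator. -/
theorem IsMaximalDissipative.exists_resolvent {A : H →ₗ.[ℝ] H} (hA : IsMaximalDissipative A)
    {lam : ℝ} (hl : 0 < lam) :
    ∃ R : H →L[ℝ] H, (∀ y, (R y, lam • R y - y) ∈ A.graph) ∧
      ∀ x z, (x, z) ∈ A.graph → R (lam • x - z) = x := by
  have huniq : ∀ x z y, (x, z) ∈ A.graph → (y, lam • y - (lam • x - z)) ∈ A.graph → y = x := by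
    intro x z y hx hy
    have := hA.norm_le lam (A.graph.sub_mem hy hx)
    have h0 : lam • (y - x) - (lam • y - (lam • x - z) - z) = 0 := by module
    rw [h0, norm_zero] at this
    have h1 : ‖y - x‖ = 0 := by
      have := norm_nonneg (y - x)
      nlinarith
    exact sub_eq_zero.1 (norm_eq_zero.1 h1)
  choose R hR using fun y => hA.exists_graph hl y
  have hinv : ∀ x z, (x, z) ∈ A.graph → R (lam • x - z) = x := fun x z hx =>
    huniq x z _ hx (hR _)
  have hbd : ∀ y, ‖R y‖ ≤ lam⁻¹ * ‖y‖ := by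
    intro y
    have := hA.norm_le lam (hR y)
    rw [sub_sub_cancel] at this
    rwa [inv_mul_eq_div, le_div_iff₀' hl]
  let Rl : H →ₗ[ℝ] H :=
    { toFun := R
      map_add' := fun y w => by
        rw [← hinv _ _ (A.graph.add_mem (hR y) (hR w))]
        congr 1; simp only; module
      map_smul' := fun c y => by
        rw [RingHom.id_apply, ← hinv _ _ (A.graph.smul_mem c (hR y))]
        congr 1; simp only; module }
  exact ⟨Rl.mkContinuous lam⁻¹ hbd, hR, hinv⟩

/-- A vector `y = x - A x` orthogonal to the domain satisfies `‖x‖² = ⟪A x, x⟫ ≤ 0`. -/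
theorem IsMaximalDissipative.dense_domain [CompleteSpace H] {A : H →ₗ.[ℝ] H}
    (hA : IsMaximalDissipative A) : Dense (A.domain : Set H) := by
  rw [Submodule.dense_iff_topologicalClosure_eq_top, Submodule.topologicalClosure_eq_top_iff,
    Submodule.eq_bot_iff]
  intro y hy
  obtain ⟨x, hx⟩ := hA.surjective 1 one_pos y
  have h1 := hy x x.2
  have h2 := hA.dissipative x
  rw [← hx, one_smul, inner_sub_right, real_inner_self_eq_norm_sq, real_inner_comm] at h1
  have h3 : (x : H) = 0 := by
    have : ‖(x : H)‖ ^ 2 ≤ 0 := by linarith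
    exact norm_eq_zero.1 (pow_eq_zero_iff two_ne_zero |>.1 (le_antisymm this (sq_nonneg _)))
  have h4 : x = 0 := Subtype.ext h3
  rw [← hx, h4]
  simp

/-- The Yosida approximations `n A (n - A)⁻¹`: bounded, dissipative, commuting, and converging
to `A` pointwise on its domain. -/
theorem IsMaximalDissipative.exists_yosida [CompleteSpace H] {A : H →ₗ.[ℝ] H}
    (hA : IsMaximalDissipative A) :
    ∃ B : ℕ → H →L[ℝ] H, (∀ n x, inner ℝ (B n x) x ≤ 0) ∧ (∀ m n, Commute (B m) (B n)) ∧
      ∀ x z, (x, z) ∈ A.graph → Tendsto (fun n => B n x) atTop (𝓝 z) := by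
  have hpos : ∀ n : ℕ, (0 : ℝ) < n + 1 := fun n => by positivity
  choose R hR hinv using fun n : ℕ => hA.exists_resolvent (hpos n)
  have hcomm : ∀ m n, Commute (R m) (R n) := by
    intro m n
    ext y
    change R m (R n y) = R n (R m y)
    set z := R n y with hz
    set x := R m z with hx
    have h1 : (z, ((n : ℝ) + 1) • z - y) ∈ A.graph := hR n y
    have h2 : (x, ((m : ℝ) + 1) • x - z) ∈ A.graph := hR m z
    -- `w = (n + 1 - A) x` satisfies `(m + 1 - A) w = y`
    have h3 := hinv m (((n : ℝ) - m) • x + z)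
      (((n : ℝ) - m) • (((m : ℝ) + 1) • x - z) + (((n : ℝ) + 1) • z - y))
      (A.graph.add_mem (A.graph.smul_mem ((n : ℝ) - m) h2) h1)
    have h4 := hinv n _ _ h2
    have e : R m y = ((n : ℝ) + 1) • x - (((m : ℝ) + 1) • x - z) := by
      refine Eq.trans ?_ (h3.trans ?_)
      · congr 1; module
      · module
    rw [e, h4]
  let B : ℕ → H →L[ℝ] H := fun n =>
    ((n : ℝ) + 1) ^ 2 • R n - ((n : ℝ) + 1) • ContinuousLinearMap.id ℝ H
  have hB : ∀ n y, B n y = ((n : ℝ) + 1) • (((n : ℝ) + 1) • R n y - y) := by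
    intro n y
    simp only [B, sub_apply, smul_apply, ContinuousLinearMap.id_apply]
    module
  refine ⟨B, ?_, ?_, ?_⟩
  · intro n y
    rw [hB]
    set x := R n y
    set l := (n : ℝ) + 1 with hl
    have h1 := hA.inner_nonpos (hR n y)
    have e : y = l • x - (l • x - y) := by module
    have h2 : inner ℝ (l • x - y) y = l * inner ℝ (l • x - y) x - ‖l • x - y‖ ^ 2 := by
      conv_lhs => rw [e, ← e]
      nth_rw 2 [e]
      rw [inner_sub_right, real_inner_smul_right, real_inner_self_eq_norm_sq]
    rw [real_inner_smul_left, h2]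
    have h3 : l * inner ℝ (l • x - y) x ≤ 0 := mul_nonpos_of_nonneg_of_nonpos (hpos n).le h1
    exact mul_nonpos_of_nonneg_of_nonpos (hpos n).le (by nlinarith [sq_nonneg ‖l • x - y‖])
  · intro m n
    have h1 : ∀ (c : ℝ) (T : H →L[ℝ] H), Commute (c • ContinuousLinearMap.id ℝ H) T :=
      fun c T => (Commute.one_left T).smul_left c
    exact (((hcomm m n).smul_left _).smul_right _ |>.sub_right (h1 _ _).symm).sub_left (h1 _ _)
  · intro x z hxz
    -- `(n + 1) R n → 1` on the domain, hence everywhere; and `B n x = (n + 1) R n z`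
    have hnorm : ∀ (n : ℕ) y, ‖((n : ℝ) + 1) • R n y‖ ≤ ‖y‖ := by
      intro n y
      have := hA.norm_le ((n : ℝ) + 1) (hR n y)
      rw [sub_sub_cancel] at this
      rwa [norm_smul, Real.norm_of_nonneg (hpos n).le]
    have hres : ∀ (n : ℕ) x z, (x, z) ∈ A.graph → ((n : ℝ) + 1) • R n x - x = R n z := by
      intro n x z h
      have := hinv n x z h
      rw [map_sub, map_smul] at this
      nth_rw 2 [← this]
      module
    have hBz : ∀ n : ℕ, B n x = ((n : ℝ) + 1) • R n z := by
      intro n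
      rw [hB, hres n x z hxz]
    simp only [hBz]
    rw [Metric.tendsto_atTop]
    intro ε hε
    obtain ⟨w, hw, hwz⟩ := Metric.dense_iff.1 hA.dense_domain z (ε / 3) (by positivity)
    obtain ⟨v, hv⟩ := LinearPMap.mem_domain_iff.1 hwz
    obtain ⟨N, hN⟩ := exists_nat_gt (‖v‖ / (ε / 3))
    refine ⟨N, fun n hn => ?_⟩
    have h1 : ‖((n : ℝ) + 1) • R n w - w‖ < ε / 3 := by
      rw [hres n w v hv]
      have h2 := hnorm n v
      rw [norm_smul, Real.norm_of_nonneg (hpos n).le] at h2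
      rw [div_lt_iff₀ (by positivity)] at hN
      have h3 : (N : ℝ) ≤ n := by exact_mod_cast hn
      by_contra! hcon
      have h4 : ((n : ℝ) + 1) * (ε / 3) ≤ ((n : ℝ) + 1) * ‖R n v‖ := by gcongr
      nlinarith
    have h2 : ‖((n : ℝ) + 1) • R n (z - w)‖ < ε / 3 := by
      refine (hnorm n _).trans_lt ?_
      rw [← dist_eq_norm, dist_comm]
      exact hw
    have h3 : ‖w - z‖ < ε / 3 := by rw [← dist_eq_norm]; exact hw
    rw [dist_eq_norm]
    calc ‖((n : ℝ) + 1) • R n z - z‖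
        = ‖((n : ℝ) + 1) • R n (z - w) + (((n : ℝ) + 1) • R n w - w) + (w - z)‖ := by
          rw [map_sub]; congr 1; module
      _ ≤ ‖((n : ℝ) + 1) • R n (z - w)‖ + ‖((n : ℝ) + 1) • R n w - w‖ + ‖w - z‖ := norm_add₃_le
      _ < ε := by linarith

end Dissipative

/-! ### The Lumer–Phillips theorem in Hilbert spaces -/

section Exponential

open NormedSpace

variable {H : Type*} [NormedAddCommGroup H] [InnerProductSpace ℝ H] [CompleteSpace H]

theorem hasDerivAt_exp_smul_apply (B : H →L[ℝ] H) (x : H) (t : ℝ) :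
    HasDerivAt (fun t : ℝ => exp (t • B) x) (B (exp (t • B) x)) t :=
  (ContinuousLinearMap.apply ℝ H x).hasFDerivAt.comp_hasDerivAt t (hasDerivAt_exp_smul_const' B t)

theorem norm_exp_smul_apply_le {B : H →L[ℝ] H} (hB : ∀ x, inner ℝ (B x) x ≤ 0) {t : ℝ}
    (ht : 0 ≤ t) (x : H) : ‖exp (t • B) x‖ ≤ ‖x‖ := by
  have := norm_le_of_inner_deriv_nonpos (u := fun t : ℝ => exp (t • B) x)
    (fun s _ => (hasDerivAt_exp_smul_apply B x s).hasDerivWithinAt) (fun s _ => hB _) ht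
  simpa using this

/-- Interpolation along `s ↦ exp ((t - s) B) exp (s C) x`, whose derivative is
`exp ((t - s) B) exp (s C) (C - B) x`. -/
theorem norm_exp_smul_sub_exp_smul_le {B C : H →L[ℝ] H} (hB : ∀ x, inner ℝ (B x) x ≤ 0)
    (hC : ∀ x, inner ℝ (C x) x ≤ 0) (hBC : Commute B C) {t : ℝ} (ht : 0 ≤ t) (x : H) :
    ‖exp (t • C) x - exp (t • B) x‖ ≤ ‖C x - B x‖ * t := by
  have hd : ∀ s, HasDerivAt (fun s : ℝ => (exp ((t - s) • B) * exp (s • C)) x)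
      (exp ((t - s) • B) (exp (s • C) (C x - B x))) s := by
    intro s
    have h1 : HasDerivAt (fun s : ℝ => exp ((t - s) • B)) (-(exp ((t - s) • B) * B)) s := by
      have := (hasDerivAt_exp_smul_const B (t - s)).scomp s ((hasDerivAt_id s).const_sub t)
      simpa [Function.comp_def] using this
    have h2 := h1.mul (hasDerivAt_exp_smul_const C s)
    have h3 := (ContinuousLinearMap.apply ℝ H x).hasFDerivAt.comp_hasDerivAt s h2
    refine h3.congr_deriv ?_
    have hc : Commute B (exp (s • C)) := (hBC.smul_right s).exp_right
    have hc' : B * exp (s • C) = exp (s • C) * B := hc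
    change (-(exp ((t - s) • B) * B) * exp (s • C) + exp ((t - s) • B) * (exp (s • C) * C)) x = _
    rw [neg_mul, mul_assoc, hc', map_sub, map_sub, add_comm, ← sub_eq_add_neg]
    rfl
  have := norm_image_sub_le_of_norm_deriv_le_segment' (a := 0) (b := t) (C := ‖C x - B x‖)
    (fun s _ => (hd s).hasDerivWithinAt) (fun s hs =>
      (norm_exp_smul_apply_le hB (by linarith [hs.2]) _).trans
        (norm_exp_smul_apply_le hC hs.1 _)) t ⟨ht, le_rfl⟩
  simpa using this

theorem norm_exp_smul_apply_sub_le {B : H →L[ℝ] H} (hB : ∀ x, inner ℝ (B x) x ≤ 0) {t : ℝ}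
    (ht : 0 ≤ t) (x : H) : ‖exp (t • B) x - x‖ ≤ ‖B x‖ * t := by
  simpa using norm_exp_smul_sub_exp_smul_le (B := 0) (by simp) hB (Commute.zero_left B) ht x

/-- The first-order expansion of `exp (h B) x`, with an error that depends on `B` only through
`B x` and `B z`. -/
theorem norm_exp_smul_apply_sub_sub_le {B : H →L[ℝ] H} (hB : ∀ x, inner ℝ (B x) x ≤ 0) {h : ℝ}
    (hh : 0 ≤ h) (x y z : H) :
    ‖exp (h • B) x - x - h • y‖ ≤ (‖B x - y‖ + 2 * ‖y - z‖ + ‖B z‖ * h) * h := by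
  have hd : ∀ s, HasDerivAt (fun s : ℝ => exp (s • B) x - s • y) (exp (s • B) (B x) - y) s := by
    intro s
    have h1 := (ContinuousLinearMap.apply ℝ H x).hasFDerivAt.comp_hasDerivAt s
      (hasDerivAt_exp_smul_const B s)
    have h2 : HasDerivAt (fun s : ℝ => exp (s • B) x) (exp (s • B) (B x)) s := h1
    exact (h2.sub ((hasDerivAt_id s).smul_const y)).congr_deriv (by simp)
  have := norm_image_sub_le_of_norm_deriv_le_segment' (a := 0) (b := h)
    (C := ‖B x - y‖ + 2 * ‖y - z‖ + ‖B z‖ * h)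
    (fun s _ => (hd s).hasDerivWithinAt) (fun s hs => ?_) h ⟨hh, le_rfl⟩
  · rw [sub_sub, add_comm x, ← sub_sub]
    simpa using this
  · have e : exp (s • B) (B x) - y = exp (s • B) (B x - y) + exp (s • B) (y - z)
        + (exp (s • B) z - z) + (z - y) := by
      simp only [map_sub]; abel
    have h1 := norm_exp_smul_apply_le hB hs.1 (B x - y)
    have h2 := norm_exp_smul_apply_le hB hs.1 (y - z)
    have h3 := norm_exp_smul_apply_sub_le hB hs.1 z
    have h4 : ‖B z‖ * s ≤ ‖B z‖ * h := by gcongr; exact hs.2.le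
    rw [e]
    refine (norm_add_le _ _).trans ?_
    have h5 := norm_add₃_le (a := exp (s • B) (B x - y)) (b := exp (s • B) (y - z))
      (c := exp (s • B) z - z)
    rw [norm_sub_rev z y]
    linarith

end Exponential

section Generation

open NormedSpace

variable {H : Type*} [NormedAddCommGroup H] [InnerProductSpace ℝ H] [CompleteSpace H]

/-- The exponentials of the Yosida approximations converge pointwise: they are Cauchy on the
domain, and contractions, so that the convergence extends to the closure of the domain. -/
theorem cauchySeq_exp_smul_apply {A : H →ₗ.[ℝ] H} (hA : Dense (A.domain : Set H))
    {B : ℕ → H →L[ℝ] H} (hB : ∀ n x, inner ℝ (B n x) x ≤ 0) (hcomm : ∀ m n, Commute (B m) (B n))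
    (hlim : ∀ x z, (x, z) ∈ A.graph → Tendsto (fun n => B n x) atTop (𝓝 z)) {t : ℝ} (ht : 0 ≤ t)
    (x : H) : CauchySeq fun n => exp (t • B n) x := by
  rw [Metric.cauchySeq_iff]
  intro ε hε
  obtain ⟨w, hw, hwd⟩ := Metric.dense_iff.1 hA x (ε / 3) (by positivity)
  obtain ⟨v, hv⟩ := LinearPMap.mem_domain_iff.1 hwd
  obtain ⟨N, hN⟩ := Metric.cauchySeq_iff.1 (hlim w v hv).cauchySeq (ε / 3 / (t + 1))
    (by positivity)
  refine ⟨N, fun m hm n hn => ?_⟩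
  have h1 := norm_exp_smul_sub_exp_smul_le (hB n) (hB m) (hcomm n m) ht w
  have h2 := hN m hm n hn
  rw [dist_eq_norm, lt_div_iff₀ (by positivity)] at h2
  have h3 : ‖B m w - B n w‖ * t ≤ ‖B m w - B n w‖ * (t + 1) := by gcongr; linarith
  have h4 := norm_exp_smul_apply_le (hB m) ht (x - w)
  have h5 := norm_exp_smul_apply_le (hB n) ht (w - x)
  have h6 : ‖x - w‖ < ε / 3 := by rw [← dist_eq_norm, dist_comm]; exact hw
  rw [norm_sub_rev w x] at h5
  rw [dist_eq_norm]
  calc ‖exp (t • B m) x - exp (t • B n) x‖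
      = ‖exp (t • B m) (x - w) + (exp (t • B m) w - exp (t • B n) w) + exp (t • B n) (w - x)‖ := by
        simp only [map_sub]; congr 1; abel
    _ ≤ _ := norm_add₃_le
    _ < ε := by linarith

/-- The Lumer–Phillips theorem in a Hilbert space: a maximal dissipative operator generates a
`C₀`-semigroup of contractions. -/
theorem IsMaximalDissipative.exists_semigroup {A : H →ₗ.[ℝ] H} (hA : IsMaximalDissipative A) :
    ∃ S : C0Semigroup H, S.IsContraction ∧ S.IsGeneratedBy A := by
  obtain ⟨B, hB, hcomm, hlim⟩ := hA.exists_yosida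
  choose f hf using fun (t : ℝ≥0) (x : H) => cauchySeq_tendsto_of_complete
    (cauchySeq_exp_smul_apply hA.dense_domain hB hcomm hlim t.2 x)
  have hadd : ∀ t x y, f t (x + y) = f t x + f t y := fun t x y =>
    tendsto_nhds_unique (hf t (x + y)) (by simpa using (hf t x).add (hf t y))
  have hsmul : ∀ t (c : ℝ) x, f t (c • x) = c • f t x := fun t c x =>
    tendsto_nhds_unique (hf t (c • x)) (by simpa using (hf t x).const_smul c)
  have hbd : ∀ t x, ‖f t x‖ ≤ 1 * ‖x‖ := fun t x => by
    rw [one_mul]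
    exact le_of_tendsto (hf t x).norm
      (Eventually.of_forall fun n => norm_exp_smul_apply_le (hB n) t.2 x)
  let T : ℝ≥0 → H →L[ℝ] H := fun t => LinearMap.mkContinuous
    { toFun := f t, map_add' := hadd t, map_smul' := hsmul t } 1 (hbd t)
  have hT : ∀ (t : ℝ≥0) x, Tendsto (fun n => exp ((t : ℝ) • B n) x) atTop (𝓝 (T t x)) := hf
  have hTle : ∀ t x, ‖T t x‖ ≤ ‖x‖ := fun t x => (hbd t x).trans_eq (one_mul _)
  have hsub : ∀ x z, (x, z) ∈ A.graph → ∀ t : ℝ≥0, ‖T t x - x‖ ≤ ‖z‖ * t := fun x z hx t =>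
    le_of_tendsto_of_tendsto' ((hT t x).sub_const x).norm ((hlim x z hx).norm.mul_const (t : ℝ))
      fun n => norm_exp_smul_apply_sub_le (hB n) t.2 x
  have hcoe : Tendsto (fun t : ℝ≥0 => (t : ℝ)) (𝓝 0) (𝓝 0) :=
    NNReal.continuous_coe.tendsto' 0 0 rfl
  let S : C0Semigroup H :=
    { toFun := T
      map_zero' := by
        ext x
        exact tendsto_nhds_unique (hT 0 x) (by simp)
      map_add' := by
        intro s t
        ext x
        refine tendsto_nhds_unique (hT (s + t) x) ?_
        have e : ∀ n, exp (((s + t : ℝ≥0) : ℝ) • B n) x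
            = exp ((s : ℝ) • B n) (exp ((t : ℝ) • B n) x) := by
          intro n
          let +nondep : NormedAlgebra ℚ (H →L[ℝ] H) := .restrictScalars ℚ ℝ _
          rw [NNReal.coe_add, add_smul, exp_add_of_commute
            (((Commute.refl (B n)).smul_left _).smul_right _)]
          rfl
        simp only [e]
        have h1 : Tendsto (fun n => exp ((s : ℝ) • B n) (exp ((t : ℝ) • B n) x - T t x)) atTop
            (𝓝 0) := by
          refine squeeze_zero_norm (fun n => norm_exp_smul_apply_le (hB n) s.2 _) ?_
          simpa using ((hT t x).sub_const (T t x)).norm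
        have h2 := h1.add (hT s (T t x))
        simpa using h2
      tendsto_zero' := by
        intro x
        rw [Metric.tendsto_nhds]
        intro ε hε
        obtain ⟨w, hw, hwd⟩ := Metric.dense_iff.1 hA.dense_domain x (ε / 3) (by positivity)
        obtain ⟨v, hv⟩ := LinearPMap.mem_domain_iff.1 hwd
        have hz : Tendsto (fun t : ℝ≥0 => ‖v‖ * (t : ℝ)) (𝓝 0) (𝓝 0) := by
          simpa using hcoe.const_mul ‖v‖
        filter_upwards [hz.eventually_lt_const (show (0 : ℝ) < ε / 3 by positivity)] with t ht
        have h1 := hsub w v hv t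
        have h2 := hTle t (x - w)
        have h3 : ‖x - w‖ < ε / 3 := by rw [← dist_eq_norm, dist_comm]; exact hw
        rw [dist_eq_norm]
        calc ‖T t x - x‖ = ‖T t (x - w) + (T t w - w) + (w - x)‖ := by
              simp only [map_sub]; congr 1; abel
          _ ≤ _ := norm_add₃_le
          _ < ε := by rw [norm_sub_rev w x]; linarith }
  refine ⟨S, fun t => ContinuousLinearMap.opNorm_le_bound _ zero_le_one (hbd t), ?_⟩
  have hfwd : ∀ x y, (x, y) ∈ A.graph →
      Tendsto (fun h : ℝ≥0 => (h : ℝ)⁻¹ • (T h x - x)) (𝓝[>] 0) (𝓝 y) := by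
    intro x y hxy
    rw [Metric.tendsto_nhds]
    intro ε hε
    obtain ⟨z, hz, hzd⟩ := Metric.dense_iff.1 hA.dense_domain y (ε / 4) (by positivity)
    obtain ⟨v, hv⟩ := LinearPMap.mem_domain_iff.1 hzd
    have hz' : Tendsto (fun t : ℝ≥0 => ‖v‖ * (t : ℝ)) (𝓝[>] 0) (𝓝 0) := by
      simpa using (hcoe.mono_left nhdsWithin_le_nhds).const_mul ‖v‖
    filter_upwards [hz'.eventually_lt_const (show (0 : ℝ) < ε / 4 by positivity),
      self_mem_nhdsWithin] with h hh hpos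
    have hpos' : (0 : ℝ) < h := hpos
    have h1 : ‖T h x - x - (h : ℝ) • y‖ ≤ (0 + 2 * ‖y - z‖ + ‖v‖ * h) * h := by
      refine le_of_tendsto_of_tendsto' (((hT h x).sub_const x).sub_const _).norm ?_
        fun n => norm_exp_smul_apply_sub_sub_le (hB n) h.2 x y z
      have h2 : Tendsto (fun n => ‖B n x - y‖) atTop (𝓝 0) := by
        simpa using ((hlim x y hxy).sub_const y).norm
      exact ((h2.add_const _).add ((hlim z v hv).norm.mul_const _)).mul_const _
    have h3 : ‖y - z‖ < ε / 4 := by rw [← dist_eq_norm, dist_comm]; exact hz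
    have h4 : (h : ℝ)⁻¹ • (T h x - x) - y = (h : ℝ)⁻¹ • (T h x - x - (h : ℝ) • y) := by
      rw [smul_sub _ _ ((h : ℝ) • y), inv_smul_smul₀ hpos'.ne']
    rw [dist_eq_norm, h4, norm_smul, norm_inv, Real.norm_of_nonneg hpos'.le,
      inv_mul_lt_iff₀ hpos']
    refine h1.trans_lt ?_
    rw [mul_comm]
    exact mul_lt_mul_of_pos_left (by linarith) hpos'
  intro x y
  refine ⟨hfwd x y, fun hxy => ?_⟩
  -- the generator extends `A` and is dissipative, whereas `1 - A` is already onto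
  obtain ⟨w, hw⟩ := hA.exists_graph one_pos (x - y)
  rw [one_smul] at hw
  have hlim' : Tendsto (fun h : ℝ≥0 => inner ℝ ((h : ℝ)⁻¹ • (T h (x - w) - (x - w))) (x - w))
      (𝓝[>] 0) (𝓝 (inner ℝ (x - w) (x - w))) := by
    refine Tendsto.inner ?_ tendsto_const_nhds
    have h2 := hxy.sub (hfwd _ _ hw)
    have e : y - (w - (x - y)) = x - w := by abel
    rw [e] at h2
    refine h2.congr fun h => ?_
    change (h : ℝ)⁻¹ • (T h x - x) - _ = _
    rw [map_sub, ← smul_sub]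
    congr 1
    abel
  have h0 : inner ℝ (x - w) (x - w) ≤ 0 := by
    refine le_of_tendsto hlim' (Eventually.of_forall fun h => ?_)
    rw [real_inner_smul_left, inner_sub_left, real_inner_self_eq_norm_sq]
    have h3 := (real_inner_le_norm (T h (x - w)) (x - w)).trans
      (mul_le_mul_of_nonneg_right (hTle h (x - w)) (norm_nonneg _))
    exact mul_nonpos_of_nonneg_of_nonpos (inv_nonneg.2 h.2) (by nlinarith)
  have h1 : x - w = 0 := by
    rw [real_inner_self_eq_norm_sq] at h0
    exact norm_eq_zero.1 (pow_eq_zero_iff two_ne_zero |>.1 (le_antisymm h0 (sq_nonneg _)))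
  have h2 : x = w := sub_eq_zero.1 h1
  rw [← h2] at hw
  simpa using hw

end Generation

/-! ### Orbits of contraction semigroups and classical solutions -/

section Orbits

variable {X : Type*} [NormedAddCommGroup X] [NormedSpace ℝ X]

theorem mem_graph_opComp_iff {g f : X →ₗ.[ℝ] X} {x z : X} :
    (x, z) ∈ (opComp g f).graph ↔ ∃ y, (x, y) ∈ f.graph ∧ (y, z) ∈ g.graph := by
  constructor
  · intro h
    obtain ⟨w, hw, hz⟩ := (LinearPMap.mem_graph_iff _).1 h
    obtain ⟨w, y, hy, rfl⟩ := w
    simp only at hw hz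
    subst hw hz
    exact ⟨f y, f.mem_graph y, g.mem_graph ⟨f y, hy⟩⟩
  · rintro ⟨y, hxy, hyz⟩
    obtain ⟨x, rfl, rfl⟩ := (LinearPMap.mem_graph_iff _).1 hxy
    obtain ⟨y, hy, rfl⟩ := (LinearPMap.mem_graph_iff _).1 hyz
    have hd : f x ∈ g.domain := by
      have := y.2
      rwa [hy] at this
    obtain rfl : y = ⟨f x, hd⟩ := Subtype.ext hy
    exact (opComp g f).mem_graph ⟨x, x, hd, rfl⟩

theorem mem_graph_opPow_zero_iff {A : X →ₗ.[ℝ] X} {x z : X} :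
    (x, z) ∈ (opPow A 0).graph ↔ z = x := by
  rw [LinearPMap.mem_graph_iff]
  constructor
  · rintro ⟨y, rfl, rfl⟩
    rfl
  · rintro rfl
    exact ⟨⟨z, trivial⟩, rfl, rfl⟩

theorem opPow_domain_antitone (A : X →ₗ.[ℝ] X) : Antitone fun n => (opPow A n).domain := by
  refine antitone_nat_of_succ_le fun n x hx => ?_
  obtain ⟨z, hz⟩ := LinearPMap.mem_domain_iff.1 hx
  obtain ⟨y, hy, _⟩ := mem_graph_opComp_iff.1 hz
  exact LinearPMap.mem_domain_of_mem_graph hy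

namespace C0Semigroup

variable {S : C0Semigroup X} {A : X →ₗ.[ℝ] X}

theorem orbit_zero (S : C0Semigroup X) (x : X) : S.orbit x 0 = x := by
  simp [orbit, S.map_zero']

theorem orbit_add (S : C0Semigroup X) (x : X) {s t : ℝ} (hs : 0 ≤ s) (ht : 0 ≤ t) :
    S.orbit x (t + s) = S.toFun t.toNNReal (S.orbit x s) := by
  rw [orbit, orbit, Real.toNNReal_add ht hs, S.map_add']
  rfl

theorem IsContraction.norm_le (hS : S.IsContraction) (t : ℝ≥0) (x : X) : ‖S.toFun t x‖ ≤ ‖x‖ := by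
  simpa using (S.toFun t).le_of_opNorm_le (hS t) x

/-- For `s ≤ t` one has `S(t) x - S(s) x = S(s) (S(t - s) x - x)`. -/
theorem IsContraction.norm_orbit_sub_le (hS : S.IsContraction) (x : X) {s t : ℝ} (hs : 0 ≤ s)
    (hst : s ≤ t) : ‖S.orbit x t - S.orbit x s‖ ≤ ‖S.orbit x (t - s) - x‖ := by
  have h1 : S.orbit x t = S.toFun s.toNNReal (S.orbit x (t - s)) := by
    rw [← S.orbit_add x (sub_nonneg.2 hst) hs, add_sub_cancel]
  rw [h1]
  simp only [orbit]
  rw [← map_sub]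
  exact hS.norm_le _ _

theorem IsContraction.continuous_orbit (hS : S.IsContraction) (x : X) :
    Continuous (S.orbit x) := by
  have hc : Continuous fun t : ℝ≥0 => S.toFun t x := by
    rw [continuous_iff_continuousAt]
    intro t
    have h0 : Tendsto (fun s : ℝ≥0 => ‖S.orbit x |(s : ℝ) - t| - x‖) (𝓝 t) (𝓝 0) := by
      have h1 : Tendsto (fun s : ℝ≥0 => |(s : ℝ) - t|.toNNReal) (𝓝 t) (𝓝 0) := by
        have : Continuous fun s : ℝ≥0 => |(s : ℝ) - t|.toNNReal := by fun_prop
        exact this.tendsto' t 0 (by simp)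
      have h2 := (((S.tendsto_zero' x).comp h1).sub_const x).norm
      rw [sub_self, norm_zero] at h2
      exact h2
    refine tendsto_iff_norm_sub_tendsto_zero.2 (squeeze_zero (fun _ => norm_nonneg _) ?_ h0)
    intro s
    have e : ∀ r : ℝ≥0, S.toFun r x = S.orbit x r := fun r => by rw [orbit, Real.toNNReal_coe]
    change ‖S.toFun s x - S.toFun t x‖ ≤ _
    rw [e, e]
    rcases le_total (t : ℝ) s with h | h
    · rw [abs_of_nonneg (sub_nonneg.2 h)]
      exact hS.norm_orbit_sub_le x t.2 h
    · rw [abs_of_nonpos (sub_nonpos.2 h), neg_sub, norm_sub_rev (S.orbit x s)]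
      exact hS.norm_orbit_sub_le x s.2 h
  exact hc.comp continuous_real_toNNReal

/-- The domain of the generator is invariant, and `A S(t) = S(t) A` there. -/
theorem IsGeneratedBy.orbit_mem_graph (hA : S.IsGeneratedBy A) {x y : X} (h : (x, y) ∈ A.graph)
    (t : ℝ) : (S.orbit x t, S.orbit y t) ∈ A.graph := by
  rw [hA]
  have h1 := ((S.toFun t.toNNReal).continuous.tendsto y).comp ((hA x y).1 h)
  refine h1.congr fun r => ?_
  have e : S.toFun t.toNNReal (S.toFun r x) = S.toFun r (S.toFun t.toNNReal x) := by
    change ((S.toFun t.toNNReal).comp (S.toFun r)) x = ((S.toFun r).comp (S.toFun t.toNNReal)) x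
    rw [← S.map_add', ← S.map_add', add_comm]
  simp only [Function.comp_apply, map_smul, map_sub, e, orbit]

theorem IsGeneratedBy.orbit_mem_graph_opPow (hA : S.IsGeneratedBy A) (n : ℕ) {x y : X}
    (h : (x, y) ∈ (opPow A n).graph) (t : ℝ) :
    (S.orbit x t, S.orbit y t) ∈ (opPow A n).graph := by
  induction n generalizing y with
  | zero =>
    rw [mem_graph_opPow_zero_iff] at h ⊢
    rw [h]
  | succ n ih =>
    obtain ⟨w, hw, hwy⟩ := mem_graph_opComp_iff.1 h
    exact mem_graph_opComp_iff.2 ⟨_, ih hw, hA.orbit_mem_graph hwy t⟩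

theorem IsContraction.continuousIntoDomPow_orbit (hS : S.IsContraction) (hA : S.IsGeneratedBy A)
    (n : ℕ) {x : X} (hx : x ∈ (opPow A n).domain) : ContinuousIntoDomPow A n (S.orbit x) := by
  intro j hj
  obtain ⟨y, hy⟩ := LinearPMap.mem_domain_iff.1 (opPow_domain_antitone A hj hx)
  exact ⟨S.orbit y, (hS.continuous_orbit y).continuousOn, fun t _ =>
    hA.orbit_mem_graph_opPow j hy t⟩

theorem IsGeneratedBy.hasDerivWithinAt_orbit (hA : S.IsGeneratedBy A) {x y : X}
    (h : (x, y) ∈ A.graph) {t : ℝ} (ht : 0 ≤ t) :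
    HasDerivWithinAt (S.orbit x) (S.orbit y t) (Ici t) t := by
  rw [hasDerivWithinAt_iff_tendsto_slope, Ici_sdiff_left]
  have h1 := (hA _ _).1 (hA.orbit_mem_graph h t)
  have h2 : Tendsto (fun s : ℝ => (s - t).toNNReal) (𝓝[>] t) (𝓝[>] 0) := by
    refine tendsto_nhdsWithin_iff.2 ⟨?_, ?_⟩
    · have : Continuous fun s : ℝ => (s - t).toNNReal := by fun_prop
      exact (this.tendsto' t 0 (by simp)).mono_left nhdsWithin_le_nhds
    · filter_upwards [self_mem_nhdsWithin] with s hs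
      exact Real.toNNReal_pos.2 (sub_pos.2 hs)
  refine (h1.comp h2).congr' ?_
  filter_upwards [self_mem_nhdsWithin] with s hs
  have hs' : 0 ≤ s - t := (sub_pos.2 hs).le
  rw [Function.comp_apply, ← S.orbit_add x ht hs', Real.coe_toNNReal _ hs', sub_add_cancel]
  rfl

/-- For `x` in the domain of the generator the orbit coincides on `[0, ∞)` with the `C¹` function
`t ↦ x + ∫₀ᵗ S(s) A x ds`, because both have the same right derivative. -/
theorem IsContraction.orbit_eqOn_integral [CompleteSpace X] (hS : S.IsContraction)
    (hA : S.IsGeneratedBy A) {x y : X} (h : (x, y) ∈ A.graph) :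
    EqOn (S.orbit x) (fun t => x + ∫ s in (0 : ℝ)..t, S.orbit y s) (Ici 0) := by
  intro t ht
  have hd : ∀ t, HasDerivAt (fun t => x + ∫ s in (0 : ℝ)..t, S.orbit y s) (S.orbit y t) t :=
    fun t => ((hS.continuous_orbit y).integral_hasStrictDerivAt 0 t).hasDerivAt.const_add x
  exact eq_of_has_deriv_right_eq (a := 0) (b := t) (f' := S.orbit y)
    (fun s hs => hA.hasDerivWithinAt_orbit h hs.1) (fun s _ => (hd s).hasDerivWithinAt)
    (hS.continuous_orbit x).continuousOn
    (fun s _ => (hd s).continuousAt.continuousWithinAt) (by simp [orbit_zero]) t ⟨ht, le_rfl⟩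

theorem IsContraction.isClassicalSolution_orbit [CompleteSpace X] (hS : S.IsContraction)
    (hA : S.IsGeneratedBy A) {x : X} (hx : x ∈ A.domain) :
    IsClassicalSolution A x (S.orbit x) := by
  obtain ⟨y, hy⟩ := LinearPMap.mem_domain_iff.1 hx
  have hd : ∀ t, HasDerivAt (fun t => x + ∫ s in (0 : ℝ)..t, S.orbit y s) (S.orbit y t) t :=
    fun t => ((hS.continuous_orbit y).integral_hasStrictDerivAt 0 t).hasDerivAt.const_add x
  have heq := hS.orbit_eqOn_integral hA hy
  refine ⟨?_, ?_, ?_, S.orbit_zero x⟩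
  · refine ContDiffOn.congr (ContDiff.contDiffOn ?_) heq
    rw [contDiff_one_iff_deriv]
    refine ⟨fun t => (hd t).differentiableAt, ?_⟩
    rw [funext fun t => (hd t).deriv]
    exact hS.continuous_orbit y
  · refine hS.continuousIntoDomPow_orbit hA 1 ?_
    exact LinearPMap.mem_domain_of_mem_graph
      (mem_graph_opComp_iff.2 ⟨x, mem_graph_opPow_zero_iff.2 rfl, hy⟩)
  · intro t ht
    rw [((hd t).hasDerivWithinAt.congr heq (heq ht)).derivWithin (uniqueDiffOn_Ici 0 t ht)]
    exact hA.orbit_mem_graph hy t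

end C0Semigroup

/-- Two classical solutions of a dissipative problem with the same initial value agree, because
the norm of their difference is nonincreasing. -/
theorem IsClassicalSolution.eqOn {H : Type*} [NormedAddCommGroup H] [InnerProductSpace ℝ H]
    {A : H →ₗ.[ℝ] H} (hA : ∀ x : A.domain, inner ℝ (A x) (x : H) ≤ 0) {x : H} {V W : ℝ → H}
    (hV : IsClassicalSolution A x V) (hW : IsClassicalSolution A x W) : EqOn V W (Ici 0) := by
  intro t ht
  have hd : ∀ {U : ℝ → H}, IsClassicalSolution A x U → ∀ t ∈ Ici (0 : ℝ),
      HasDerivWithinAt U (derivWithin U (Ici 0) t) (Ici 0) t := fun hU t ht =>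
    (hU.contDiffOn.differentiableOn (by simp) t ht).hasDerivWithinAt
  have h := norm_le_of_inner_deriv_nonpos (fun t ht => (hd hV t ht).sub (hd hW t ht))
    (fun t ht => by
      obtain ⟨y, hy, hy'⟩ := (LinearPMap.mem_graph_iff _).1
        (A.graph.sub_mem (hV.equation t ht) (hW.equation t ht))
      have := hA y
      rw [hy, hy'] at this
      exact this) ht
  simp only [Pi.sub_apply, hV.initial, hW.initial, sub_self, norm_zero] at h
  exact sub_eq_zero.1 (norm_le_zero_iff.1 h)

end Orbits

/-! ### Integration by parts and the Poincaré inequality -/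

section Sobolev

variable {L : ℝ}

theorem IsTest.hasDerivAt {φ : ℝ → ℝ} (h : IsTest L φ) (x : ℝ) : HasDerivAt φ (deriv φ x) x :=
  (h.contDiff.differentiable (by simp) x).hasDerivAt

theorem IsTest.apply_zero {φ : ℝ → ℝ} (h : IsTest L φ) : φ 0 = 0 :=
  image_eq_zero_of_notMem_tsupport fun hx => by simpa using h.tsupport_subset hx

theorem IsTest.apply_right {φ : ℝ → ℝ} (h : IsTest L φ) : φ L = 0 :=
  image_eq_zero_of_notMem_tsupport fun hx => by simpa using h.tsupport_subset hx

theorem IsTest.mk_mem_testGraph {φ : ℝ → ℝ} (h : IsTest L φ) :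
    (h.memLp.toLp φ, h.memLp_deriv.toLp (deriv φ)) ∈ testGraph L :=
  ⟨φ, h, h.memLp.coeFn_toLp, h.memLp_deriv.coeFn_toLp⟩

theorem inner_eq_setIntegral (u v : L2 L) {f : ℝ → ℝ} (hv : v =ᵐ[μI L] f) :
    inner ℝ u v = ∫ x in Ioo 0 L, u x * f x := by
  rw [L2.inner_def]
  apply integral_congr_ae
  filter_upwards [hv] with x hx
  rw [hx]
  simp [mul_comm]

/-- The weak derivative is the negative adjoint of the derivative of test functions. -/
theorem hasWeakDeriv_iff_inner {u v : L2 L} :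
    HasWeakDeriv L u v ↔ ∀ p ∈ testGraph L, inner ℝ u p.2 = -inner ℝ v p.1 := by
  constructor
  · rintro h p ⟨φ, hφ, h1, h2⟩
    rw [inner_eq_setIntegral _ _ h1, inner_eq_setIntegral _ _ h2]
    exact h φ hφ
  · intro h φ hφ
    have := h _ hφ.mk_mem_testGraph
    rwa [inner_eq_setIntegral _ _ hφ.memLp.coeFn_toLp,
      inner_eq_setIntegral _ _ hφ.memLp_deriv.coeFn_toLp] at this

/-- Integration by parts between `H¹` and `H¹₀`. -/
theorem HasWeakDeriv.inner_eq {u v : L2 L} (h : HasWeakDeriv L u v) {p : L2 L × L2 L}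
    (hp : p ∈ (testGraph L).topologicalClosure) : inner ℝ u p.2 = -inner ℝ v p.1 := by
  have hcl : IsClosed {p : L2 L × L2 L | inner ℝ u p.2 = -inner ℝ v p.1} :=
    isClosed_eq (by fun_prop) (by fun_prop)
  exact closure_minimal (fun p hp => hasWeakDeriv_iff_inner.1 h p hp) hcl hp

theorem hasWeakDeriv_of_mem_testGraph (hL : 0 ≤ L) {p : L2 L × L2 L} (hp : p ∈ testGraph L) :
    HasWeakDeriv L p.1 p.2 := by
  obtain ⟨η, hη, h1, h2⟩ := hp
  intro φ hφ
  have e1 : ∫ x in Ioo 0 L, p.1 x * deriv φ x = ∫ x in Ioo 0 L, η x * deriv φ x :=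
    integral_congr_ae (h1.mono fun x hx => by simp only [hx])
  have e2 : ∫ x in Ioo 0 L, p.2 x * φ x = ∫ x in Ioo 0 L, deriv η x * φ x :=
    integral_congr_ae (h2.mono fun x hx => by simp only [hx])
  rw [e1, e2, ← integral_Ioc_eq_integral_Ioo, ← integral_Ioc_eq_integral_Ioo,
    ← intervalIntegral.integral_of_le hL, ← intervalIntegral.integral_of_le hL,
    intervalIntegral.integral_mul_deriv_eq_deriv_mul (fun x _ => hη.hasDerivAt x)
      (fun x _ => hφ.hasDerivAt x) (hη.continuous_deriv.intervalIntegrable _ _)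
      (hφ.continuous_deriv.intervalIntegrable _ _), hη.apply_zero, hη.apply_right]
  simp

theorem hasWeakDeriv_of_mem_closure (hL : 0 ≤ L) {p : L2 L × L2 L}
    (hp : p ∈ (testGraph L).topologicalClosure) : HasWeakDeriv L p.1 p.2 := by
  rw [hasWeakDeriv_iff_inner]
  intro q hq
  have := (hasWeakDeriv_of_mem_testGraph hL hq).inner_eq hp
  rw [real_inner_comm, real_inner_comm q.1, this, neg_neg]

theorem mem_closure_testGraph_iff (hL : 0 ≤ L) {u v : L2 L} :
    (u, v) ∈ (testGraph L).topologicalClosure ↔ ∃ h : u ∈ H10 L, D0 L ⟨u, h⟩ = v := by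
  constructor
  · intro h
    have hw : HasWeakDeriv L u v := hasWeakDeriv_of_mem_closure hL h
    have h1 : u ∈ H1 L := (mem_H1_iff u).2 ⟨v, hw⟩
    have e : weakD L ⟨u, h1⟩ = v := weakD_eq ⟨u, h1⟩ hw
    exact ⟨(mem_H10_iff ⟨u, h1⟩).2 (by rw [e]; exact h), e⟩
  · rintro ⟨h, rfl⟩
    exact D0_mem_closure ⟨u, h⟩

/-- The Poincaré inequality. For a test function, `∫ φ² = -2 ∫ x φ φ'` because the integral of
`(x φ²)'` vanishes. -/
theorem norm_fst_le_of_mem_closure (hL : 0 ≤ L) {p : L2 L × L2 L}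
    (hp : p ∈ (testGraph L).topologicalClosure) : ‖p.1‖ ≤ 2 * L * ‖p.2‖ := by
  have hcl : IsClosed {p : L2 L × L2 L | ‖p.1‖ ≤ 2 * L * ‖p.2‖} :=
    isClosed_le (by fun_prop) (by fun_prop)
  refine closure_minimal ?_ hcl hp
  rintro p ⟨φ, hφ, h1, h2⟩
  have hbd : ∀ᵐ x ∂μI L, ‖x‖ ≤ L := by
    filter_upwards [ae_restrict_mem measurableSet_Ioo] with x hx
    rw [Real.norm_of_nonneg hx.1.le]
    exact hx.2.le
  have hg : MemLp (fun x => x * deriv φ x) 2 (μI L) := by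
    refine hφ.memLp_deriv.of_le_mul (c := L)
      (continuous_id.mul hφ.continuous_deriv).aestronglyMeasurable ?_
    filter_upwards [hbd] with x hx
    rw [norm_mul]
    gcongr
  have hgn : ‖hg.toLp‖ ≤ L * ‖p.2‖ := by
    refine Lp.norm_le_mul_norm_of_ae_le_mul ?_
    filter_upwards [hbd, hg.coeFn_toLp, h2] with x hx h3 h4
    rw [h3, h4, norm_mul]
    gcongr
  have key : inner ℝ p.1 p.1 + 2 * inner ℝ p.1 hg.toLp = 0 := by
    have hc := hφ.contDiff.continuous
    have hc' := hφ.continuous_deriv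
    have e : ∀ {f : ℝ → ℝ}, ∫ x in Ioo 0 L, p.1 x * f x = ∫ x in (0)..L, φ x * f x := by
      intro f
      rw [intervalIntegral.integral_of_le hL, integral_Ioc_eq_integral_Ioo]
      exact integral_congr_ae (h1.mono fun x hx => by simp only [hx])
    rw [inner_eq_setIntegral _ _ h1, inner_eq_setIntegral _ _ hg.coeFn_toLp, e, e,
      ← intervalIntegral.integral_const_mul, ← intervalIntegral.integral_add
        (f := fun x => φ x * φ x) (g := fun x => 2 * (φ x * (x * deriv φ x)))
        ((hc.mul hc).intervalIntegrable _ _)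
        ((continuous_const.mul (hc.mul (continuous_id.mul hc'))).intervalIntegrable _ _)]
    have hd : ∀ x ∈ uIcc 0 L, HasDerivAt (fun x => x * (φ x * φ x))
        (φ x * φ x + 2 * (φ x * (x * deriv φ x))) x := fun x _ =>
      ((hasDerivAt_id x).mul ((hφ.hasDerivAt x).mul (hφ.hasDerivAt x))).congr_deriv
        (by simp only [id, Pi.mul_apply]; ring)
    rw [intervalIntegral.integral_eq_sub_of_hasDerivAt hd (Continuous.intervalIntegrable
      ((hc.mul hc).add (continuous_const.mul (hc.mul (continuous_id.mul hc')))) _ _)]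
    simp [hφ.apply_right]
  rw [real_inner_self_eq_norm_sq] at key
  have h3 := neg_le_of_abs_le (abs_real_inner_le_norm p.1 hg.toLp)
  have h4 : ‖p.1‖ * ‖hg.toLp‖ ≤ ‖p.1‖ * (L * ‖p.2‖) := by gcongr
  simp only [mem_ofPred_eq]
  rcases (norm_nonneg p.1).eq_or_lt with h0 | h0
  · rw [← h0]; positivity
  · exact le_of_mul_le_mul_left (by nlinarith) h0

theorem mk_D0_mem_topologicalClosure (u : H10 L) :
    ((u : L2 L), D0 L u) ∈ (testGraph L).topologicalClosure :=
  D0_mem_closure u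

theorem norm_le_D0 (hL : 0 ≤ L) (u : H10 L) : ‖(u : L2 L)‖ ≤ 2 * L * ‖D0 L u‖ :=
  norm_fst_le_of_mem_closure (p := ((u : L2 L), D0 L u)) hL (mk_D0_mem_topologicalClosure u)

theorem D0_eq_of_hasWeakDeriv (u : H10 L) {v : L2 L} (h : HasWeakDeriv L u v) : D0 L u = v :=
  weakD_eq (⟨u, H10_le_H1 L u.2⟩ : H1 L) h

theorem hasWeakDeriv_D0 (u : H10 L) : HasWeakDeriv L u (D0 L u) :=
  hasWeakDeriv_weakD (⟨u, H10_le_H1 L u.2⟩ : H1 L)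

theorem mem_H2_of_hasWeakDeriv {u v w : L2 L} (huv : HasWeakDeriv L u v)
    (hvw : HasWeakDeriv L v w) : ∃ h : u ∈ H2 L, weakD2 L ⟨u, h⟩ = w := by
  have e1 : ∀ {u v : L2 L}, HasWeakDeriv L u v → (u, v) ∈ (weakD L).graph := fun {u v} h => by
    rw [LinearPMap.mem_graph_iff]
    exact ⟨⟨u, (mem_H1_iff u).2 ⟨v, h⟩⟩, rfl, weakD_eq _ h⟩
  obtain ⟨y, hy, hyw⟩ := (LinearPMap.mem_graph_iff _).1
    (mem_graph_opComp_iff.2 ⟨v, e1 huv, e1 hvw⟩ : (u, w) ∈ (weakD2 L).graph)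
  simp only at hy hyw
  subst hy
  exact ⟨y.2, hyw⟩

theorem hasWeakDeriv_weakD2 (u : H10 L) (h : (u : L2 L) ∈ H2 L) :
    HasWeakDeriv L (D0 L u) (weakD2 L ⟨u, h⟩) := by
  obtain ⟨v, huv, hvw⟩ := mem_graph_opComp_iff.1 ((weakD2 L).mem_graph ⟨u, h⟩)
  have e1 : ∀ {u v : L2 L}, (u, v) ∈ (weakD L).graph → HasWeakDeriv L u v := fun {u v} h => by
    obtain ⟨y, hy, hyw⟩ := (LinearPMap.mem_graph_iff _).1 h
    simp only at hy hyw
    subst hy hyw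
    exact hasWeakDeriv_weakD y
  rw [D0_eq_of_hasWeakDeriv u (e1 huv)]
  exact e1 hvw

end Sobolev

/-! ### Completeness of the energy space -/

namespace EnergySpace

variable {P : BeamCoeffs}

theorem norm_sq_eq (V : EnergySpace P) : ‖V‖ ^ 2 =
    P.ρ₁ * ‖V2 V‖ ^ 2 + P.ρ₂ * ‖V4 V‖ ^ 2 + P.b * ‖D0 P.L (V3 V)‖ ^ 2
      + P.k * ‖D0 P.L (V1 V) + (V3 V : L2 P.L)‖ ^ 2 + P.ρ₃ * ‖V5 V‖ ^ 2 + P.τ₀ * ‖V6 V‖ ^ 2 := by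
  rw [← real_inner_self_eq_norm_sq, inner_eq, energyInner]
  simp only [real_inner_self_eq_norm_sq]

/-- A Cauchy sequence in the energy norm has Cauchy components `V²`, `V⁴`, `V³ₓ`, `V¹ₓ + V³`, `V⁵`,
`V⁶`; by the Poincaré inequality `V³` and `V¹` are Cauchy in `H¹₀`, which is complete. -/
theorem completeSpace (P : BeamCoeffs) : CompleteSpace (EnergySpace P) := by
  have hL := P.L_pos.le
  refine Metric.complete_of_cauchySeq_tendsto fun V hV => ?_
  have hcau : ∀ (T : EnergySpace P →ₗ[ℝ] L2 P.L) (c : ℝ), 0 < c →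
      (∀ V, c * ‖T V‖ ^ 2 ≤ ‖V‖ ^ 2) → CauchySeq fun n => T (V n) := by
    intro T c hc hT
    have : ∀ V, ‖T V‖ ≤ (Real.sqrt c)⁻¹ * ‖V‖ := by
      intro V
      rw [inv_mul_eq_div, le_div_iff₀ (Real.sqrt_pos.2 hc)]
      refine le_of_sq_le_sq ?_ (norm_nonneg _)
      rw [mul_pow, Real.sq_sqrt hc.le, mul_comm]
      exact hT V
    exact (T.mkContinuous _ this).uniformContinuous.comp_cauchySeq hV
  let T1 : EnergySpace P →ₗ[ℝ] L2 P.L := D0 P.L ∘ₗ V1 + (H10 P.L).subtype ∘ₗ V3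
  let T3 : EnergySpace P →ₗ[ℝ] L2 P.L := D0 P.L ∘ₗ V3
  have hpos := fun V : EnergySpace P => show 0 ≤ P.ρ₁ * ‖V2 V‖ ^ 2 ∧ 0 ≤ P.ρ₂ * ‖V4 V‖ ^ 2 ∧
      0 ≤ P.b * ‖T3 V‖ ^ 2 ∧ 0 ≤ P.k * ‖T1 V‖ ^ 2 ∧ 0 ≤ P.ρ₃ * ‖V5 V‖ ^ 2 ∧
      0 ≤ P.τ₀ * ‖V6 V‖ ^ 2 by
    have h1 := P.ρ₁_pos; have h2 := P.ρ₂_pos; have h3 := P.ρ₃_pos; have h4 := P.k_pos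
    have h5 := P.b_pos; have h6 := P.τ₀_pos
    refine ⟨?_, ?_, ?_, ?_, ?_, ?_⟩ <;> positivity
  have hns : ∀ V : EnergySpace P, ‖V‖ ^ 2 = P.ρ₁ * ‖V2 V‖ ^ 2 + P.ρ₂ * ‖V4 V‖ ^ 2
      + P.b * ‖T3 V‖ ^ 2 + P.k * ‖T1 V‖ ^ 2 + P.ρ₃ * ‖V5 V‖ ^ 2 + P.τ₀ * ‖V6 V‖ ^ 2 := norm_sq_eq
  have c2 := hcau V2 _ P.ρ₁_pos fun V => by linarith [hpos V, hns V]
  have c4 := hcau V4 _ P.ρ₂_pos fun V => by linarith [hpos V, hns V]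
  have c3 := hcau T3 _ P.b_pos fun V => by linarith [hpos V, hns V]
  have c1 := hcau T1 _ P.k_pos fun V => by linarith [hpos V, hns V]
  have c5 := hcau V5 _ P.ρ₃_pos fun V => by linarith [hpos V, hns V]
  have c6 := hcau V6 _ P.τ₀_pos fun V => by linarith [hpos V, hns V]
  have hlim : ∀ U : ℕ → H10 P.L, (CauchySeq fun n => D0 P.L (U n)) →
      ∃ u : H10 P.L, Tendsto (fun n => (U n : L2 P.L)) atTop (𝓝 u) ∧
        Tendsto (fun n => D0 P.L (U n)) atTop (𝓝 (D0 P.L u)) := by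
    intro U hU
    have hU' : CauchySeq fun n => (U n : L2 P.L) := by
      rw [Metric.cauchySeq_iff] at hU ⊢
      intro ε hε
      obtain ⟨N, hN⟩ := hU (ε / (2 * P.L)) (by have := P.L_pos; positivity)
      refine ⟨N, fun m hm n hn => ?_⟩
      have h1 := hN m hm n hn
      have h2 := norm_le_D0 hL (U m - U n)
      rw [dist_eq_norm, lt_div_iff₀ (by have := P.L_pos; positivity)] at h1
      rw [map_sub, Submodule.coe_sub] at h2
      rw [dist_eq_norm]
      linarith
    obtain ⟨v, hv⟩ := cauchySeq_tendsto_of_complete hU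
    obtain ⟨u, hu⟩ := cauchySeq_tendsto_of_complete hU'
    have hmem : (u, v) ∈ (testGraph P.L).topologicalClosure :=
      (testGraph P.L).isClosed_topologicalClosure.mem_of_tendsto (hu.prodMk_nhds hv)
        (Eventually.of_forall fun n => D0_mem_closure (U n))
    obtain ⟨h, rfl⟩ := (mem_closure_testGraph_iff hL).1 hmem
    exact ⟨⟨u, h⟩, hu, hv⟩
  obtain ⟨w3, hw3, hw3'⟩ := hlim (fun n => V3 (V n)) c3
  obtain ⟨v1, hv1⟩ := cauchySeq_tendsto_of_complete c1
  obtain ⟨w1, -, hw1'⟩ := hlim (fun n => V1 (V n))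
    ((hv1.sub hw3).congr fun n => add_sub_cancel_right _ _).cauchySeq
  obtain ⟨w2, hw2⟩ := cauchySeq_tendsto_of_complete c2
  obtain ⟨w4, hw4⟩ := cauchySeq_tendsto_of_complete c4
  obtain ⟨w5, hw5⟩ := cauchySeq_tendsto_of_complete c5
  obtain ⟨w6, hw6⟩ := cauchySeq_tendsto_of_complete c6
  refine ⟨EnergySpace.mk w1 w2 w3 w4 w5 w6, ?_⟩
  rw [tendsto_iff_norm_sub_tendsto_zero]
  have hz : ∀ {f : ℕ → L2 P.L} {a : L2 P.L} (c : ℝ), Tendsto f atTop (𝓝 a) →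
      Tendsto (fun n => c * ‖f n - a‖ ^ 2) atTop (𝓝 0) := fun {f a} c h => by
    simpa using (((h.sub_const a).norm).pow 2).const_mul c
  have hsum := ((((((hz P.ρ₁ hw2).add (hz P.ρ₂ hw4)).add (hz P.b hw3')).add
    (hz P.k (hw1'.add hw3))).add (hz P.ρ₃ hw5)).add (hz P.τ₀ hw6)).sqrt
  simp only [add_zero, Real.sqrt_zero] at hsum
  refine hsum.congr fun n => ?_
  rw [← Real.sqrt_sq (norm_nonneg (V n - _)), norm_sq_eq]
  simp only [map_sub, V1_mk, V2_mk, V3_mk, V4_mk, V5_mk, V6_mk, Submodule.coe_sub]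
  rw [add_sub_add_comm]

end EnergySpace

/-! ### Weighted projections -/

/-- The best approximation of `X` in a closed subspace of a power of a Hilbert space, with respect
to a weighted inner product. -/
theorem exists_mem_forall_sum_mul_inner_eq_zero {ι E : Type*} [Fintype ι] [NormedAddCommGroup E]
    [InnerProductSpace ℝ E] [CompleteSpace E] (M : Submodule ℝ (ι → E))
    (hM : IsClosed (M : Set (ι → E))) {c : ι → ℝ} (hc : ∀ i, 0 < c i) (X : ι → E) :
    ∃ x ∈ M, ∀ y ∈ M, ∑ i, c i * inner ℝ (X i - x i) (y i) = 0 := by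
  -- rescaling the coordinates by `√cᵢ` turns the weighted inner product into the one of `ℓ²`
  let Φ : PiLp 2 (fun _ : ι => E) →L[ℝ] (ι → E) :=
    ContinuousLinearMap.pi fun i => (√(c i))⁻¹ • PiLp.proj 2 (fun _ : ι => E) i
  have hΦ : ∀ g i, Φ g i = (√(c i))⁻¹ • g i := fun g i => rfl
  have hs : ∀ i, √(c i) ≠ 0 := fun i => (Real.sqrt_pos.2 (hc i)).ne'
  let K : Submodule ℝ (PiLp 2 (fun _ : ι => E)) := M.comap Φ.toLinearMap
  have hK : IsClosed (K : Set (PiLp 2 (fun _ : ι => E))) := hM.preimage Φ.continuous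
  have : CompleteSpace K := hK.completeSpace_coe
  let G : PiLp 2 (fun _ : ι => E) := WithLp.toLp 2 fun i => √(c i) • X i
  have hP : K.starProjection G ∈ K := K.starProjection_apply_mem G
  refine ⟨Φ (K.starProjection G), hP, fun y hy => ?_⟩
  have hy' : (WithLp.toLp 2 fun i => √(c i) • y i : PiLp 2 (fun _ : ι => E)) ∈ K := by
    change Φ _ ∈ M
    convert hy using 1
    ext i
    rw [hΦ]
    exact inv_smul_smul₀ (hs i) _
  have h := K.starProjection_inner_eq_zero G _ hy'
  rw [PiLp.inner_apply] at h
  rw [← h]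
  refine Finset.sum_congr rfl fun i _ => ?_
  have e : (G - K.starProjection G) i = √(c i) • (X i - Φ (K.starProjection G) i) := by
    rw [hΦ, smul_sub, smul_inv_smul₀ (hs i)]
    rfl
  rw [e, real_inner_smul_left, real_inner_smul_right, ← mul_assoc, Real.mul_self_sqrt (hc i).le]

/-! ### The beam operator is maximal dissipative -/

section Beam

open EnergySpace

variable {P : BeamCoeffs}

theorem beamOp_apply (V : (beamOp P).domain) : beamOp P V = EnergySpace.mk
    ⟨V2 V.1, V.2.2.1⟩
    ((P.k / P.ρ₁) • weakD2 P.L ⟨V1 V.1, V.2.1⟩ - (P.μ / P.ρ₁) • V2 V.1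
      + (P.k / P.ρ₁) • D0 P.L (V3 V.1))
    ⟨V4 V.1, V.2.2.2.2.1⟩
    (-((P.k / P.ρ₂) • D0 P.L (V1 V.1)) + (P.b / P.ρ₂) • weakD2 P.L ⟨V3 V.1, V.2.2.2.1⟩
      - (P.k / P.ρ₂) • (V3 V.1 : L2 P.L) - (P.γ / P.ρ₂) • weakD P.L ⟨V5 V.1, V.2.2.2.2.2.1⟩)
    (-((P.γ / P.ρ₃) • D0 P.L ⟨V4 V.1, V.2.2.2.2.1⟩)
      - (P.κ / P.ρ₃) • D0 P.L ⟨V6 V.1, V.2.2.2.2.2.2⟩)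
    (-((P.κ / P.τ₀) • weakD P.L ⟨V5 V.1, V.2.2.2.2.2.1⟩) - (P.δ / P.τ₀) • V6 V.1) := rfl

/-- Weak derivatives `w1`, `w3`, `w5` of `V¹ₓ`, `V³ₓ`, `V⁵` place `V` in the domain and compute
`A V`. -/
theorem beamOp_apply_of_hasWeakDeriv {v1 v3 : H10 P.L} {v2 v4 v5 v6 w1 w3 w5 d4 d6 : L2 P.L}
    (hw1 : HasWeakDeriv P.L (D0 P.L v1) w1) (hw3 : HasWeakDeriv P.L (D0 P.L v3) w3)
    (hw5 : HasWeakDeriv P.L v5 w5) (h2 : v2 ∈ H10 P.L)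
    (h4 : ∃ h : v4 ∈ H10 P.L, D0 P.L ⟨v4, h⟩ = d4) (h6 : ∃ h : v6 ∈ H10 P.L, D0 P.L ⟨v6, h⟩ = d6) :
    ∃ V : (beamOp P).domain, (V : EnergySpace P) = EnergySpace.mk v1 v2 v3 v4 v5 v6 ∧
      beamOp P V = EnergySpace.mk ⟨v2, h2⟩
        ((P.k / P.ρ₁) • w1 - (P.μ / P.ρ₁) • v2 + (P.k / P.ρ₁) • D0 P.L v3)
        ⟨v4, h4.1⟩
        (-((P.k / P.ρ₂) • D0 P.L v1) + (P.b / P.ρ₂) • w3 - (P.k / P.ρ₂) • (v3 : L2 P.L)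
          - (P.γ / P.ρ₂) • w5)
        (-((P.γ / P.ρ₃) • d4) - (P.κ / P.ρ₃) • d6)
        (-((P.κ / P.τ₀) • w5) - (P.δ / P.τ₀) • v6) := by
  obtain ⟨g1, e1⟩ := mem_H2_of_hasWeakDeriv (hasWeakDeriv_D0 v1) hw1
  obtain ⟨g3, e3⟩ := mem_H2_of_hasWeakDeriv (hasWeakDeriv_D0 v3) hw3
  have g5 : v5 ∈ H1 P.L := (mem_H1_iff v5).2 ⟨w5, hw5⟩
  have e5 : weakD P.L ⟨v5, g5⟩ = w5 := weakD_eq _ hw5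
  obtain ⟨h4, rfl⟩ := h4
  obtain ⟨h6, rfl⟩ := h6
  subst e1 e3 e5
  exact ⟨⟨EnergySpace.mk v1 v2 v3 v4 v5 v6, g1, h2, g3, h4, g5, h6⟩, rfl, rfl⟩

/-- The energy identity `⟪A V, V⟫ = -μ ‖V²‖² - δ ‖V⁶‖²`: all other terms cancel after
integration by parts. -/
theorem inner_beamOp_self (V : (beamOp P).domain) :
    inner ℝ (beamOp P V) (V : EnergySpace P)
      = -(P.μ * ‖V2 V.1‖ ^ 2) - P.δ * ‖V6 V.1‖ ^ 2 := by
  have r1 := P.ρ₁_pos.ne'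
  have r2 := P.ρ₂_pos.ne'
  have r3 := P.ρ₃_pos.ne'
  have r4 := P.τ₀_pos.ne'
  rw [inner_eq, energyInner, beamOp_apply]
  simp only [V1_mk, V2_mk, V3_mk, V4_mk, V5_mk, V6_mk]
  have k1 := (hasWeakDeriv_weakD2 (V1 V.1) V.2.1).inner_eq
    (mk_D0_mem_topologicalClosure ⟨V2 V.1, V.2.2.1⟩)
  have k2 := (hasWeakDeriv_D0 (V3 V.1)).inner_eq
    (mk_D0_mem_topologicalClosure ⟨V2 V.1, V.2.2.1⟩)
  have k3 := (hasWeakDeriv_weakD2 (V3 V.1) V.2.2.2.1).inner_eq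
    (mk_D0_mem_topologicalClosure ⟨V4 V.1, V.2.2.2.2.1⟩)
  have k4 := (hasWeakDeriv_weakD ⟨V5 V.1, V.2.2.2.2.2.1⟩).inner_eq
    (mk_D0_mem_topologicalClosure ⟨V4 V.1, V.2.2.2.2.1⟩)
  have k5 := (hasWeakDeriv_weakD ⟨V5 V.1, V.2.2.2.2.2.1⟩).inner_eq
    (mk_D0_mem_topologicalClosure ⟨V6 V.1, V.2.2.2.2.2.2⟩)
  simp only at k1 k2 k3 k4 k5
  generalize weakD2 P.L ⟨V1 V.1, V.2.1⟩ = w1 at *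
  generalize weakD2 P.L ⟨V3 V.1, V.2.2.2.1⟩ = w3 at *
  generalize weakD P.L ⟨V5 V.1, V.2.2.2.2.2.1⟩ = w5 at *
  generalize D0 P.L ⟨V2 V.1, V.2.2.1⟩ = d2 at *
  generalize D0 P.L ⟨V4 V.1, V.2.2.2.2.1⟩ = d4 at *
  generalize D0 P.L ⟨V6 V.1, V.2.2.2.2.2.2⟩ = d6 at *
  simp only [inner_add_left, inner_sub_left, inner_neg_left, real_inner_smul_left,
    inner_add_right, real_inner_self_eq_norm_sq]
  rw [real_inner_comm] at k1 k2 k3 k4 k5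
  have k6 := real_inner_comm (V4 V.1) (D0 P.L (V1 V.1))
  have k7 := real_inner_comm (V4 V.1) (V3 V.1 : L2 P.L)
  field_simp
  linear_combination P.k * k1 + P.k * k2 + P.b * k3 - P.γ * k4 - P.κ * k5 - P.k * k6 - P.k * k7

/-- The resolvent equation `l V - A V = F` for `l > 0`. Eliminating `V¹`, `V³`, `V⁵` turns it into a
symmetric coercive variational problem for `(u, v, w) = (V², V⁴, V⁶)` in `(H¹₀)³`. It says that
`x = (u, uₓ + v, v, vₓ, γ vₓ + κ wₓ, w)` is the best approximation, in a weighted norm of `(L²)⁶`,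
of a vector given by `F` among all vectors of this form. These form a closed subspace, so that the
orthogonal projection provides `x`. Testing with test functions for `u`, `v` and `w` yields the
weak derivatives that place `V` in the domain. -/
theorem beamOp_surjective (P : BeamCoeffs) {l : ℝ} (hl : 0 < l) (F : EnergySpace P) :
    ∃ V : (beamOp P).domain, l • (V : EnergySpace P) - beamOp P V = F := by
  have hL := P.L_pos.le
  have a1 := P.ρ₁_pos; have a2 := P.ρ₂_pos; have a3 := P.ρ₃_pos; have a4 := P.k_pos
  have a5 := P.b_pos; have a6 := P.τ₀_pos; have a7 := P.κ_pos; have a8 := P.μ_pos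
  have a9 := P.δ_pos
  let T := (testGraph P.L).topologicalClosure
  have hT : IsClosed (T : Set (L2 P.L × L2 P.L)) := (testGraph P.L).isClosed_topologicalClosure
  -- `y ∈ M` iff `y = (u, uₓ + v, v, vₓ, γ vₓ + κ wₓ, w)` with `u, v, w ∈ H¹₀`
  let pr : Fin 6 → (Fin 6 → L2 P.L) →L[ℝ] L2 P.L := ContinuousLinearMap.proj
  let f1 := (pr 0).prod (pr 1 - pr 2)
  let f2 := (pr 2).prod (pr 3)
  let f3 := (pr 5).prod (P.κ⁻¹ • (pr 4 - P.γ • pr 3))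
  let M : Submodule ℝ (Fin 6 → L2 P.L) :=
    T.comap f1.toLinearMap ⊓ T.comap f2.toLinearMap ⊓ T.comap f3.toLinearMap
  have hM : IsClosed (M : Set (Fin 6 → L2 P.L)) :=
    ((hT.preimage f1.continuous).inter (hT.preimage f2.continuous)).inter
      (hT.preimage f3.continuous)
  have hmem : ∀ y : Fin 6 → L2 P.L, y ∈ M ↔ ((y 0, y 1 - y 2) ∈ T ∧ (y 2, y 3) ∈ T) ∧
      (y 5, P.κ⁻¹ • (y 4 - P.γ • y 3)) ∈ T := fun y => Iff.rfl
  -- opaque names keep `field_simp` from splitting these two coefficients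
  obtain ⟨c0, hc0⟩ : ∃ c, c = l * P.ρ₁ + P.μ := ⟨_, rfl⟩
  obtain ⟨c5, hc5⟩ : ∃ c, c = l * P.τ₀ + P.δ := ⟨_, rfl⟩
  have p0 : 0 < c0 := by rw [hc0]; positivity
  have p5 : 0 < c5 := by rw [hc5]; positivity
  let c : Fin 6 → ℝ := ![c0, P.k / l, l * P.ρ₂, P.b / l, 1 / (l * P.ρ₃), c5]
  have hc : ∀ i, 0 < c i := by
    intro i
    fin_cases i <;> simp only [c, Fin.reduceFinMk, Fin.zero_eta, Fin.isValue, Fin.mk_one,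
      Matrix.cons_val] <;> positivity
  obtain ⟨x, hx, horth⟩ := exists_mem_forall_sum_mul_inner_eq_zero M hM hc
    ![(P.ρ₁ / c0) • V2 F, -(D0 P.L (V1 F) + (V3 F : L2 P.L)), (1 / l) • V4 F, -D0 P.L (V3 F),
      P.ρ₃ • V5 F, (P.τ₀ / c5) • V6 F]
  simp only [Fin.sum_univ_six, c, Fin.isValue, Matrix.cons_val] at horth
  obtain ⟨⟨hx1, hx2⟩, hx3⟩ := (hmem x).1 hx
  generalize x 0 = x0 at *
  generalize x 1 = x1 at *
  generalize x 2 = x2 at *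
  generalize x 3 = x3 at *
  generalize x 4 = x4 at *
  generalize x 5 = x5 at *
  have hz : (0 : L2 P.L × L2 P.L) ∈ T := T.zero_mem
  have hle : testGraph P.L ≤ T := Submodule.le_topologicalClosure _
  -- the tested equation for `u`: it gives `k (V¹ₓ + V³) ∈ H¹`
  have W1 : HasWeakDeriv P.L ((P.k / l) • (x1 + (D0 P.L (V1 F) + (V3 F : L2 P.L))))
      (c0 • x0 - P.ρ₁ • V2 F) := by
    refine hasWeakDeriv_iff_inner.2 fun p hp => ?_
    have h := horth ![p.1, p.2, 0, 0, 0, 0] ((hmem _).2 (by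
      simp only [Fin.isValue, Matrix.cons_val, sub_zero, smul_zero]
      exact ⟨⟨hle hp, hz⟩, hz⟩))
    simp only [Fin.isValue, Matrix.cons_val, inner_zero_right, mul_zero, add_zero,
      inner_sub_left, inner_neg_left, inner_add_left, real_inner_smul_left] at h ⊢
    field_simp at h ⊢
    linear_combination -h
  -- the tested equation for `v`: it gives `b V³ₓ - γ V⁵ ∈ H¹`
  have W2 : HasWeakDeriv P.L ((P.b / l) • (x3 + D0 P.L (V3 F))
        + (P.γ / (l * P.ρ₃)) • (x4 - P.ρ₃ • V5 F))
      ((P.k / l) • (x1 + (D0 P.L (V1 F) + (V3 F : L2 P.L))) + (l * P.ρ₂) • x2 - P.ρ₂ • V4 F) := by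
    refine hasWeakDeriv_iff_inner.2 fun p hp => ?_
    have h := horth ![0, p.1, p.1, p.2, P.γ • p.2, 0] ((hmem _).2 (by
      simp only [Fin.isValue, Matrix.cons_val, sub_self, smul_zero]
      exact ⟨⟨hz, hle hp⟩, hz⟩))
    simp only [Fin.isValue, Matrix.cons_val, inner_zero_right, mul_zero, add_zero, zero_add,
      inner_sub_left, inner_neg_left, inner_add_left, real_inner_smul_left,
      real_inner_smul_right] at h ⊢
    field_simp at h ⊢
    linear_combination -h
  -- the tested equation for `w`: it gives `V⁵ ∈ H¹`
  have W3 : HasWeakDeriv P.L ((1 / (l * P.ρ₃)) • (P.ρ₃ • V5 F - x4))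
      ((1 / P.κ) • (P.τ₀ • V6 F - c5 • x5)) := by
    refine hasWeakDeriv_iff_inner.2 fun p hp => ?_
    have h := horth ![0, 0, 0, 0, P.κ • p.2, p.1] ((hmem _).2 (by
      simp only [Fin.isValue, Matrix.cons_val, sub_zero, smul_zero, inv_smul_smul₀ a7.ne']
      exact ⟨⟨hz, hz⟩, hle hp⟩))
    simp only [Fin.isValue, Matrix.cons_val, inner_zero_right, mul_zero, add_zero, zero_add,
      inner_sub_left, real_inner_smul_left, real_inner_smul_right] at h ⊢
    field_simp at h ⊢
    linear_combination h
  obtain ⟨m0, e0⟩ := (mem_closure_testGraph_iff hL).1 hx1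
  obtain ⟨m2, e2⟩ := (mem_closure_testGraph_iff hL).1 hx2
  obtain ⟨m5, e5⟩ := (mem_closure_testGraph_iff hL).1 hx3
  let v1 : H10 P.L := (1 / l) • (V1 F + ⟨x0, m0⟩)
  let v3 : H10 P.L := (1 / l) • (V3 F + ⟨x2, m2⟩)
  have d1 : D0 P.L v1 = (1 / l) • (D0 P.L (V1 F) + (x1 - x2)) := by
    simp only [v1, map_smul, map_add, e0]
  have d3 : D0 P.L v3 = (1 / l) • (D0 P.L (V3 F) + x3) := by
    simp only [v3, map_smul, map_add, e2]
  have q3 : (v3 : L2 P.L) = (1 / l) • ((V3 F : L2 P.L) + x2) := rfl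
  have hadd : ∀ {u v u' v' : L2 P.L} (a b : ℝ), HasWeakDeriv P.L u v → HasWeakDeriv P.L u' v' →
      HasWeakDeriv P.L (a • u + b • u') (a • v + b • v') := fun {u v u' v'} a b h h' =>
    (weakDerivGraph P.L).add_mem ((weakDerivGraph P.L).smul_mem a (x := (u, v)) h)
      ((weakDerivGraph P.L).smul_mem b (x := (u', v')) h')
  have U1 := hadd (1 / P.k) (-1) W1 (hasWeakDeriv_D0 v3)
  have U3 := hadd (1 / P.b) (P.γ / P.b) W2 W3
  have t1 : (1 / P.k) • (P.k / l) • (x1 + (D0 P.L (V1 F) + (V3 F : L2 P.L))) + (-1 : ℝ) • v3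
      = D0 P.L v1 := by
    rw [d1, q3]
    match_scalars <;> field_simp
    ring
  have t3 : (1 / P.b) • ((P.b / l) • (x3 + D0 P.L (V3 F))
        + (P.γ / (l * P.ρ₃)) • (x4 - P.ρ₃ • V5 F))
      + (P.γ / P.b) • (1 / (l * P.ρ₃)) • (P.ρ₃ • V5 F - x4) = D0 P.L v3 := by
    rw [d3]
    match_scalars <;> field_simp <;> ring
  rw [t1] at U1
  rw [t3] at U3
  obtain ⟨V, hV, hAV⟩ := beamOp_apply_of_hasWeakDeriv U1 U3 W3 m0 ⟨m2, e2⟩ ⟨m5, e5⟩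
  refine ⟨V, ?_⟩
  rw [hV, hAV]
  ext1 <;> simp only [map_sub, map_smul, V1_mk, V2_mk, V3_mk, V4_mk, V5_mk, V6_mk]
  · simp only [v1, one_div, smul_inv_smul₀ hl.ne', add_sub_cancel_right]
  · rw [hc0]
    match_scalars <;> field_simp <;> ring
  · simp only [v3, one_div, smul_inv_smul₀ hl.ne', add_sub_cancel_right]
  · rw [d1, q3]
    match_scalars <;> field_simp <;> ring
  · match_scalars <;> field_simp <;> ring
  · rw [hc5]
    match_scalars <;> field_simp
    ring

theorem isMaximalDissipative_beamOp (P : BeamCoeffs) : IsMaximalDissipative (beamOp P) where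
  dissipative V := by
    have := P.μ_pos
    have := P.δ_pos
    rw [inner_beamOp_self]
    have h1 : 0 ≤ P.μ * ‖V2 V.1‖ ^ 2 := by positivity
    have h2 : 0 ≤ P.δ * ‖V6 V.1‖ ^ 2 := by positivity
    linarith
  surjective _ hl F := beamOp_surjective P hl F

end Beam

theorem mainTheorem7 (P : BeamCoeffs) :
    CompleteSpace (EnergySpace P) ∧
    ∃ S : C0Semigroup (EnergySpace P),
      S.IsContraction ∧ S.IsGeneratedBy (beamOp P) ∧
      (∀ V₀ ∈ (beamOp P).domain,
        IsClassicalSolution (beamOp P) V₀ (S.orbit V₀) ∧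
        ∀ V : ℝ → EnergySpace P, IsClassicalSolution (beamOp P) V₀ V →
          Set.EqOn V (S.orbit V₀) (Set.Ici 0)) ∧
      (∀ n : ℕ, ∀ V₀ ∈ (opPow (beamOp P) n).domain,
        ContinuousIntoDomPow (beamOp P) n (S.orbit V₀)) := by
  have := EnergySpace.completeSpace P
  have hA := isMaximalDissipative_beamOp P
  obtain ⟨S, hS, hSA⟩ := hA.exists_semigroup
  refine ⟨this, S, hS, hSA, fun V₀ hV₀ => ?_, fun n V₀ hV₀ =>
    hS.continuousIntoDomPow_orbit hSA n hV₀⟩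
  have h := hS.isClassicalSolution_orbit hSA hV₀
  exact ⟨h, fun V hV => hV.eqOn hA.dissipative h⟩
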